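/- Let $X_1,X_2,\dots$ be i.i.d. with $P(X_i=-1)=P(X_i=0)=P(X_i=1)=\tfrac13$, let $W_N=\sum_{i\le N}X_i\big/\sqrt{\sum_{i\le N}X_i^2}$ (with $W_N=0$ if all $X_i$, $i\le N$, vanish), and let $F_N$ be the distribution function of $W_N$. Let $\Phi$ and $\varphi$ be the standard normal distribution function and density. Let $\psi\ge 0$ be the characteristic function of a probability law on $\mathbb R$ such that $\psi$ is supported in $[-1,1]$ and the law has a density bounded by $A\exp(-a|x|^{2/3})$ for some constants $A,a>0$. For $N\ge 3$ put $M=\lfloor\log N\rfloor$, $f_{N,k}=\psi\bigl(2\pi\sqrt{2/3}\,k/\log N\bigr)$ and $$\lambda_N(w)=\sqrt{\tfrac32}\,\varphi(w)\sum_{k=1}^{M}\frac1{\pi k}\,f_{N,k}\,\exp\Bigl(-\frac{\pi^2}{6}k^2w^2\Bigr)\sin\Bigl(2\pi k w\sqrt{\tfrac{2N}{3}}\Bigr).$$ Theorem 1.2. There is an absolute constant $c>0$ such that, for every such $\psi$ and for all positive integers $N$ divisible by $3$, $$\sup_{w>0}|F_N(w)-\Phi(w)|\ \ge\ \sup_{w\ge1}N^{-1/2}|\lambda_N(w)|+R_N\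 >\ \frac{c}{\sqrt N}$$ for some real numbers $R_N$ with $R_N=O\bigl(N^{-1}(\log N)^5\bigr)$, where the implied constant depends only on the chosen law. In particular the oscillatory term is genuinely of order $N^{-1/2}$: for every such $\psi$, $\sup_{w\ge1}|\lambda_N(w)|>c$ for all sufficiently large $N$ divisible by $3$. Moreover the normal approximation error is of exact order $N^{-1/2}$: there is also an absolute constant $C_0$ with $c/\sqrt N<\sup_{w>0}|F_N(w)-\Phi(w)|\le C_0/\sqrt N$ for all positive integers $N$ divisible by $3$. -/

import Mathlib

open MeasureTheory ProbabilityTheory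

noncomputable section

/-- The common law of the summands: mass `1/3` at each of `-1`, `0`, `1`. -/
def stepLaw : Measure ℝ :=
  (3 : ENNReal)⁻¹ • (Measure.dirac (-1) + Measure.dirac 0 + Measure.dirac 1)

/-- The self-normalized sum `(∑ xᵢ) / √(∑ xᵢ²)`. If all `xᵢ` vanish, Lean's `0 / 0 = 0` gives
the value `0`, which is the convention wanted here. -/
def selfNormalizedSum {N : ℕ} (x : Fin N → ℝ) : ℝ :=
  (∑ i, x i) / √(∑ i, x i ^ 2)

/-- The distribution function `F_N(w) = P(W_N ≤ w)` of the self-normalized sum `W_N` of `N`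
independent random variables with law `stepLaw` (realized on the product space). -/
def distFun (N : ℕ) (w : ℝ) : ℝ :=
  (Measure.pi fun _ : Fin N => stepLaw).real {x | selfNormalizedSum x ≤ w}

/-- The error of the normal approximation on the positive half-line,
`sup_{w > 0} |F_N(w) - Φ(w)|`; the supremum is over a set of numbers in `[0, 1]`. -/
def normalApproxError (N : ℕ) : ℝ :=
  ⨆ w : Set.Ioi (0 : ℝ), |distFun N w - cdf (gaussianReal 0 1) w|

/-- Smoothing laws: probability measures on the line whose characteristic function is real,
nonnegative and supported in `[-1, 1]`, and which have a density decaying like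
`exp (-a |x| ^ (2/3))`. -/
structure IsSmoothingLaw (μ : Measure ℝ) : Prop where
  isProbabilityMeasure : IsProbabilityMeasure μ
  charFun_im : ∀ t : ℝ, (charFun μ t).im = 0
  charFun_nonneg : ∀ t : ℝ, 0 ≤ (charFun μ t).re
  charFun_support : ∀ t : ℝ, 1 < |t| → charFun μ t = 0
  density_decay : ∃ p : ℝ → ℝ, Measurable p ∧ (∀ x, 0 ≤ p x) ∧
    μ = volume.withDensity (fun x => ENNReal.ofReal (p x)) ∧
    ∃ A a : ℝ, 0 < a ∧ ∀ x, p x ≤ A * Real.exp (-a * |x| ^ (2 / 3 : ℝ))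

/-- The damping factors `f_{N,k} = ψ(2π √(2/3) k / log N)`, with `ψ` the (real-valued)
characteristic function of the smoothing law `μ`. -/
def dampingFactor (μ : Measure ℝ) (N k : ℕ) : ℝ :=
  (charFun μ (2 * Real.pi * √(2 / 3) * k / Real.log N)).re

/-- The oscillating Fourier sum `λ_N(w)`, with `M = ⌊log N⌋` terms. -/
def oscillatingSum (μ : Measure ℝ) (N : ℕ) (w : ℝ) : ℝ :=
  √(3 / 2) * gaussianPDFReal 0 1 w *
    ∑ k ∈ Finset.Icc 1 ⌊Real.log N⌋₊,
      1 / (Real.pi * k) * dampingFactor μ N k *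
        Real.exp (-(Real.pi ^ 2 / 6) * (k : ℝ) ^ 2 * w ^ 2) *
        Real.sin (2 * Real.pi * k * w * √(2 * N / 3))

/-- `sup_{w ≥ 1} |λ_N(w)|`; the supremum is over a bounded set since `λ_N` is bounded. -/
def oscillatingSumSup (μ : Measure ℝ) (N : ℕ) : ℝ :=
  ⨆ w : Set.Ici (1 : ℝ), |oscillatingSum μ N w|

end

-- Given the number n of nonzero summands, the sum is a simple random walk after n steps and the sum
-- of squares equals n. Hence for w ≥ 0 the distribution function of W_N is the Bin(N, 2/3)-average
-- of the walk's distribution function at w√n (`distFun_eq`). An exact inversion formula for the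
-- walk (`walkCdf_eq`), compared with its Gaussian counterpart, gives Φ plus a lattice correction of
-- order n^(-1/2): a sawtooth in (w√n - n)/2, with error O(1/n) uniformly in w
-- (`abs_walkCdf_sub_le`). Averaging over n keeps this form (`abs_mixCdf_sub_sub_le`) and already
-- yields the upper bound C₀/√N.
--
-- The averaged sawtooth is analysed mode by mode. Convolving with the smoothing law at scale 1/(√N
-- log N) cuts its Fourier series to finitely many modes (`IsSmoothingLaw.integral_sawtooth`). In
-- the k-th mode the phase πk(w√n - n) is linearised in n around 2N/3. For odd k the sign (-1)^n
-- makes the average negligible; for even k a central limit comparison leaves the factor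
-- exp(-π²k²w²/24) (`abs_binMean_mode_sub_le`). With k = 2j the surviving modes add up to λ_N
-- (`oscillatingSum_eq`). Smoothing does not increase the sup error, except where the shifted
-- argument is nonpositive, which for w ≥ 1 costs only O(1/N) by the second moment. So |λ_N(w)|/√N
-- is at most the error plus O((log N)^5/N) (`abs_oscillatingSum_le`).
--
-- Two lower bounds finish the proof. The atom of W_N at 0 forces F_N(0) - 1/2 ≥ 1/(30√N) for every
-- N ≥ 1 (`inv_sqrt_le_normalApproxError`). For large N, at a point w where the first mode peaks,
-- that mode dominates the others, so sup |λ_N| is bounded below (`exists_le_oscillatingSumSup`).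
-- The remainder R_N is then chosen to fit: the negative part of the gap for large N, the whole gap
-- for the finitely many small N (`exists_remainder`).

local notation "Φ" => ProbabilityTheory.cdf (ProbabilityTheory.gaussianReal 0 1)
local notation "φ" => ProbabilityTheory.gaussianPDFReal 0 1

/-! ### The standard normal distribution -/

lemma stdPDF_eq (x : ℝ) : φ x = (√(2 * Real.pi))⁻¹ * Real.exp (-x ^ 2 / 2) := by
  simp [gaussianPDFReal]

lemma continuous_stdPDF : Continuous (fun x => φ x) := by
  simp_rw [stdPDF_eq]; fun_prop

lemma stdPDF_nonneg (x : ℝ) : 0 ≤ φ x := gaussianPDFReal_nonneg _ _ _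

lemma inv_sqrt_two_pi_le_half : (√(2 * Real.pi))⁻¹ ≤ 1 / 2 := by
  rw [one_div]
  apply inv_anti₀ (by norm_num)
  apply Real.le_sqrt_of_sq_le
  nlinarith [Real.pi_gt_three]

lemma abs_pow_three_mul_exp_le (x : ℝ) : |x| ^ 3 * Real.exp (-x ^ 2 / 2) ≤ 8 := by
  have h1 : (x ^ 2 / 2) ^ 2 / 2 + x ^ 2 / 2 + 1 ≤ Real.exp (x ^ 2 / 2) := by
    linarith [Real.quadratic_le_exp_of_nonneg (show 0 ≤ x ^ 2 / 2 by positivity)]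
  have h2 : |x| ^ 3 ≤ 8 * Real.exp (x ^ 2 / 2) := by
    rw [← sq_abs x] at h1 ⊢
    have h0 := abs_nonneg x
    generalize |x| = y at h0 h1 ⊢
    nlinarith [sq_nonneg (y ^ 2 - y / 2), sq_nonneg (y - 1), sq_nonneg y]
  calc |x| ^ 3 * Real.exp (-x ^ 2 / 2) ≤ 8 * Real.exp (x ^ 2 / 2) * Real.exp (-x ^ 2 / 2) := by
        gcongr
    _ = 8 := by rw [mul_assoc, ← Real.exp_add]; ring_nf; simp

lemma exp_neg_sq_div_two_le_one (x : ℝ) : Real.exp (-x ^ 2 / 2) ≤ 1 := by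
  rw [Real.exp_le_one_iff]; nlinarith [sq_nonneg x]

lemma stdPDF_le_one (x : ℝ) : φ x ≤ 1 := by
  rw [stdPDF_eq]
  have := exp_neg_sq_div_two_le_one x
  have := inv_sqrt_two_pi_le_half
  have := Real.exp_pos (-x ^ 2 / 2)
  nlinarith

/-- The mode errors grow like (1 + |w|)³; the prefactor φ(w) absorbs this growth and makes the final
estimate uniform in w. -/
lemma stdPDF_mul_le (x : ℝ) : φ x * (1 + |x|) ^ 3 ≤ 64 := by
  rw [stdPDF_eq]
  have h1 := exp_neg_sq_div_two_le_one x
  have h2 := inv_sqrt_two_pi_le_half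
  have h3 := Real.exp_pos (-x ^ 2 / 2)
  have h4 := abs_pow_three_mul_exp_le x
  have h5 : (1 + |x|) ^ 3 ≤ 8 * (1 + |x| ^ 3) := by
    have := abs_nonneg x
    nlinarith [sq_nonneg (|x| - 1), mul_nonneg this (sq_nonneg (|x| - 1))]
  have h6 : 0 ≤ (√(2 * Real.pi))⁻¹ := by positivity
  calc (√(2 * Real.pi))⁻¹ * Real.exp (-x ^ 2 / 2) * (1 + |x|) ^ 3
      ≤ 1 / 2 * Real.exp (-x ^ 2 / 2) * (8 * (1 + |x| ^ 3)) := by gcongr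
    _ ≤ 64 := by nlinarith

lemma hasDerivAt_stdPDF (x : ℝ) : HasDerivAt (fun x => φ x) (-x * φ x) x := by
  simp_rw [stdPDF_eq]
  have h : HasDerivAt (fun x : ℝ => -x ^ 2 / 2) (-x) x := by
    have := ((hasDerivAt_pow 2 x).neg).div_const 2
    convert! this using 1; simp; ring
  convert! (h.exp.const_mul (√(2 * Real.pi))⁻¹) using 1; ring

lemma abs_deriv_stdPDF_le (x : ℝ) : |-x * φ x| ≤ 1 := by
  rw [abs_mul, abs_neg, abs_of_nonneg (stdPDF_nonneg x), stdPDF_eq]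
  have h2 := inv_sqrt_two_pi_le_half
  have h1 : x ^ 2 / 2 + 1 ≤ Real.exp (x ^ 2 / 2) := Real.add_one_le_exp _
  have h3 : |x| ≤ Real.exp (x ^ 2 / 2) := by
    rw [← sq_abs] at h1 ⊢
    nlinarith [sq_nonneg (|x| - 1)]
  have h4 : |x| * Real.exp (-x ^ 2 / 2) ≤ 1 := by
    calc |x| * Real.exp (-x ^ 2 / 2) ≤ Real.exp (x ^ 2 / 2) * Real.exp (-x ^ 2 / 2) := by gcongr
      _ = 1 := by rw [← Real.exp_add]; ring_nf; simp
  have h5 : 0 ≤ |x| * Real.exp (-x ^ 2 / 2) := by positivity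
  have h6 : 0 ≤ (√(2 * Real.pi))⁻¹ := by positivity
  nlinarith

lemma abs_stdPDF_sub_le (x y : ℝ) : |φ x - φ y| ≤ |x - y| := by
  have := Convex.norm_image_sub_le_of_norm_hasDerivWithin_le (s := Set.univ)
    (f := fun x => φ x) (f' := fun x => -x * φ x) (C := 1)
    (fun x _ => (hasDerivAt_stdPDF x).hasDerivWithinAt)
    (fun x _ => by simpa using abs_deriv_stdPDF_le x) convex_univ (Set.mem_univ y) (Set.mem_univ x)
  simpa using this

lemma stdCdf_eq_integral (x : ℝ) : Φ x = ∫ t in Set.Iic x, φ t := by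
  rw [cdf_eq_real, measureReal_def, gaussianReal_apply_eq_integral 0 one_ne_zero,
    ENNReal.toReal_ofReal]
  exact integral_nonneg fun t => stdPDF_nonneg t

lemma hasDerivAt_stdCdf (x : ℝ) : HasDerivAt (fun x => Φ x) (φ x) x := by
  have h : (fun x => Φ x) = fun x => Φ 0 + ∫ t in (0 : ℝ)..x, φ t := by
    ext x
    rw [stdCdf_eq_integral, stdCdf_eq_integral,
      ← intervalIntegral.integral_Iic_sub_Iic (integrable_gaussianPDFReal 0 1).integrableOn
        (integrable_gaussianPDFReal 0 1).integrableOn]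
    ring
  rw [h]
  exact (intervalIntegral.integral_hasDerivAt_right
    (continuous_stdPDF.intervalIntegrable _ _)
    (continuous_stdPDF.stronglyMeasurableAtFilter _ _)
    continuous_stdPDF.continuousAt).const_add _

lemma stdCdf_zero : Φ 0 = 1 / 2 := by
  have h1 : ∫ t in Set.Iic (0 : ℝ), φ t = ∫ t in Set.Ioi (0 : ℝ), φ t := by
    have := integral_comp_neg_Iic (0 : ℝ) (fun t => φ t)
    simpa [stdPDF_eq] using this
  have h2 := integral_gaussianPDFReal_eq_one 0 (v := 1) one_ne_zero
  rw [← integral_add_compl (s := Set.Iic (0 : ℝ)) measurableSet_Iic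
    (integrable_gaussianPDFReal 0 1), Set.compl_Iic] at h2
  rw [stdCdf_eq_integral]
  linarith

/-- Mean value inequality for s ↦ Φ(w + s) - φ(w)s on |s| ≤ |h|: since φ is 1-Lipschitz, the
derivative there is at most |h|. -/
lemma abs_stdCdf_sub_taylor_le (w h : ℝ) : |Φ (w + h) - Φ w - φ w * h| ≤ h ^ 2 := by
  have := Convex.norm_image_sub_le_of_norm_hasDerivWithin_le (s := Set.Icc (-|h|) |h|)
    (f := fun s => Φ (w + s) - φ w * s) (f' := fun s => φ (w + s) - φ w) (C := |h|)
    (fun s _ => by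
      have h1 : HasDerivAt (fun s => Φ (w + s)) (φ (w + s)) s :=
        (hasDerivAt_stdCdf (w + s)).comp_const_add w s
      have h2 : HasDerivAt (fun s => φ w * s) (φ w) s := by
        simpa using (hasDerivAt_id s).const_mul (φ w)
      exact (h1.sub h2).hasDerivWithinAt)
    (fun s hs => by
      refine (abs_stdPDF_sub_le _ _).trans ?_
      rw [add_sub_cancel_left]
      exact abs_le.2 hs) (convex_Icc _ _) (x := 0) (y := h)
    (by simp) ⟨neg_abs_le h, le_abs_self h⟩
  simp only [add_zero, mul_zero, sub_zero, Real.norm_eq_abs] at this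
  rw [← sq_abs h, sq]
  convert! this using 2
  ring

/-! ### Dirichlet-type integrals of Gaussian weights -/

/-- Half the real part of the Gaussian Fourier transform, by evenness. It serves as the a-derivative
of the Dirichlet-type integral below. -/
lemma integral_exp_mul_cos {n : ℝ} (hn : 0 < n) (a : ℝ) :
    ∫ t in Set.Ioi (0 : ℝ), Real.exp (-n * t ^ 2 / 2) * Real.cos (a * t) =
      Real.pi * (φ (a / √n) / √n) := by
  have h1 := fourierIntegral_gaussian (b := (n / 2 : ℝ)) (by simpa using hn) a
  have h2 : ∫ t : ℝ, Real.exp (-n * t ^ 2 / 2) * Real.cos (a * t) =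
      2 * ∫ t in Set.Ioi (0 : ℝ), Real.exp (-n * t ^ 2 / 2) * Real.cos (a * t) := by
    rw [← integral_comp_abs (f := fun t => Real.exp (-n * t ^ 2 / 2) * Real.cos (a * t))]
    congr with t
    rw [sq_abs]
    rcases abs_cases t with h | h <;> rw [h.1]
    rw [mul_neg, Real.cos_neg]
  have h3 : ∫ t : ℝ, Real.exp (-n * t ^ 2 / 2) * Real.cos (a * t) =
      √(2 * Real.pi / n) * Real.exp (-a ^ 2 / (2 * n)) := by
    have h4 := congrArg Complex.re h1
    have h5 : ((Real.pi : ℂ) / ((n / 2 : ℝ) : ℂ)) ^ (1 / 2 : ℂ) *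
        Complex.exp (-(a : ℂ) ^ 2 / (4 * ((n / 2 : ℝ) : ℂ))) =
        ((√(2 * Real.pi / n) * Real.exp (-a ^ 2 / (2 * n)) : ℝ) : ℂ) := by
      rw [Real.sqrt_eq_rpow, Complex.ofReal_mul, Complex.ofReal_cpow (by positivity)]
      push_cast
      congr 2
      · field_simp
      · field_simp; ring
    rw [h5, Complex.ofReal_re] at h4
    rw [← h4, ← RCLike.re_eq_complex_re, ← integral_re]
    · congr with t
      have : Complex.exp (Complex.I * a * t) * Complex.exp (-((n / 2 : ℝ) : ℂ) * (t : ℂ) ^ 2) =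
        Complex.exp ((a * t : ℝ) * Complex.I) * ((Real.exp (-n * t ^ 2 / 2) : ℝ) : ℂ) := by
        push_cast; congr 2 <;> ring
      rw [this, RCLike.re_eq_complex_re, Complex.re_mul_ofReal, Complex.exp_ofReal_mul_I_re,
        mul_comm]
    · simp_rw [← Complex.exp_add]
      refine (integrable_cexp_quadratic (b := ((n / 2 : ℝ) : ℂ)) (by simpa using hn)
        (Complex.I * a) 0).congr (.of_forall fun t => ?_)
      simp only; congr 1; ring
  rw [h3] at h2
  rw [stdPDF_eq, div_pow, Real.sq_sqrt hn.le]
  have h6 : √(2 * Real.pi / n) = √(2 * Real.pi) / √n := Real.sqrt_div' _ hn.le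
  have h7 : √(2 * Real.pi) * √(2 * Real.pi) = 2 * Real.pi :=
    Real.mul_self_sqrt (by positivity)
  have h8 : Real.pi * (√(2 * Real.pi))⁻¹ = √(2 * Real.pi) / 2 := by
    rw [mul_inv_eq_iff_eq_mul₀ (by positivity)]; linarith
  have h9 : -a ^ 2 / (2 * n) = -(a ^ 2 / n) / 2 := by field_simp
  rw [h6, h9] at h2
  calc _ = √(2 * Real.pi) / 2 * Real.exp (-(a ^ 2 / n) / 2) / √n := by linear_combination -h2 / 2
    _ = _ := by rw [← h8]; ring

/-- The Gaussian analogue of the Dirichlet integral. -/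
lemma integral_exp_mul_sin_div {n : ℝ} (hn : 0 < n) (a : ℝ) :
    ∫ t in Set.Ioi (0 : ℝ), Real.exp (-n * t ^ 2 / 2) * (Real.sin (a * t) / t) =
      Real.pi * (Φ (a / √n) - 1 / 2) := by
  have hint : Integrable (fun t : ℝ => Real.exp (-n * t ^ 2 / 2))
      (volume.restrict (Set.Ioi (0 : ℝ))) := by
    refine ((integrable_exp_neg_mul_sq (half_pos hn)).congr
      (.of_forall fun t => ?_)).integrableOn
    simp only; congr 1; ring
  have hbd : ∀ x : ℝ, ∀ t ∈ Set.Ioi (0 : ℝ),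
      |Real.exp (-n * t ^ 2 / 2) * (Real.sin (x * t) / t)| ≤
        |x| * Real.exp (-n * t ^ 2 / 2) := fun x t ht => by
    have ht : 0 < t := ht
    rw [abs_mul, Real.abs_exp, mul_comm]
    refine mul_le_mul_of_nonneg_right ?_ (Real.exp_pos _).le
    rw [abs_div, div_le_iff₀ (abs_pos.2 ht.ne'), ← abs_mul]
    exact Real.abs_sin_le_abs
  have hmeas : ∀ x : ℝ, AEStronglyMeasurable
      (fun t : ℝ => Real.exp (-n * t ^ 2 / 2) * (Real.sin (x * t) / t))
      (volume.restrict (Set.Ioi (0 : ℝ))) := fun x =>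
    (by fun_prop : Measurable
      (fun t : ℝ => Real.exp (-n * t ^ 2 / 2) * (Real.sin (x * t) / t))).aestronglyMeasurable
  have hderiv : ∀ x : ℝ, HasDerivAt
      (fun x => ∫ t in Set.Ioi (0 : ℝ), Real.exp (-n * t ^ 2 / 2) * (Real.sin (x * t) / t))
      (Real.pi * (φ (x / √n) / √n)) x := fun x => by
    rw [← integral_exp_mul_cos hn]
    refine (hasDerivAt_integral_of_dominated_loc_of_deriv_le
      (bound := fun t => Real.exp (-n * t ^ 2 / 2))
      (F' := fun x t => Real.exp (-n * t ^ 2 / 2) * Real.cos (x * t))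
      Filter.univ_mem (.of_forall hmeas) ?_ ?_ ?_ hint ?_).2
    · refine (hint.const_mul |x|).mono' (hmeas x) ?_
      filter_upwards [ae_restrict_mem measurableSet_Ioi] with t ht using hbd x t ht
    · exact (by fun_prop : Measurable _).aestronglyMeasurable
    · refine .of_forall fun t y _ => ?_
      rw [norm_mul, Real.norm_eq_abs, Real.abs_exp]
      exact mul_le_of_le_one_right (Real.exp_pos _).le (Real.abs_cos_le_one _)
    · filter_upwards [ae_restrict_mem measurableSet_Ioi] with t ht y _
      have ht : t ≠ 0 := (show 0 < t from ht).ne'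
      have h1 : HasDerivAt (fun y => Real.sin (y * t)) (Real.cos (y * t) * t) y := by
        simpa using ((hasDerivAt_id y).mul_const t).sin
      convert! (h1.div_const t).const_mul (Real.exp (-n * t ^ 2 / 2)) using 1
      field_simp
  have hΦ : ∀ x : ℝ, HasDerivAt (fun x => Real.pi * (Φ (x / √n) - 1 / 2))
      (Real.pi * (φ (x / √n) / √n)) x := fun x => by
    have h1 : HasDerivAt (fun x : ℝ => Φ (x / √n)) (φ (x / √n) * (1 / √n)) x :=
      (hasDerivAt_stdCdf (x / √n)).comp x ((hasDerivAt_id x).div_const _)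
    convert! (h1.sub_const (1 / 2)).const_mul Real.pi using 1
    ring
  -- Both sides have the same derivative in a and vanish at a = 0.
  have := is_const_of_deriv_eq_zero (𝕜 := ℝ) (f := fun x =>
      (∫ t in Set.Ioi (0 : ℝ), Real.exp (-n * t ^ 2 / 2) * (Real.sin (x * t) / t)) -
        Real.pi * (Φ (x / √n) - 1 / 2))
    (fun x => ((hderiv x).sub (hΦ x)).differentiableAt)
    (fun x => (((hderiv x).sub (hΦ x)).congr_deriv (sub_self _)).deriv) a 0
  simp only [zero_mul, Real.sin_zero, zero_div, mul_zero, integral_zero, stdCdf_zero,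
    sub_self] at this
  linarith

/-! ### The simple random walk -/

/-- The distribution function of the simple symmetric random walk after `n` steps. -/
noncomputable def walkCdf : ℕ → ℝ → ℝ
  | 0, x => if 0 ≤ x then 1 else 0
  | n + 1, x => (walkCdf n (x - 1) + walkCdf n (x + 1)) / 2

lemma walkCdf_mem_Icc (n : ℕ) (x : ℝ) : walkCdf n x ∈ Set.Icc 0 1 := by
  induction n generalizing x with
  | zero => rw [walkCdf]; split_ifs <;> simp
  | succ n ih =>
    have h1 := ih (x - 1)
    have h2 := ih (x + 1)
    rw [walkCdf]
    constructor <;> linarith [h1.1, h1.2, h2.1, h2.2]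

/-- The Dirichlet-type integral which inverts the characteristic function of the walk. -/
noncomputable def walkIntegral (n : ℕ) (a : ℝ) : ℝ :=
  ∫ t in Set.Ioc 0 (Real.pi / 2), Real.cos t ^ n * (Real.sin (a * t) / Real.sin t)

lemma two_div_pi_mul_le_sin {t : ℝ} (ht : t ∈ Set.Ioc 0 (Real.pi / 2)) :
    2 / Real.pi * t ≤ Real.sin t :=
  Real.mul_le_sin ht.1.le ht.2

lemma half_le_sin {t : ℝ} (ht : t ∈ Set.Ioc 0 (Real.pi / 2)) : t / 2 ≤ Real.sin t := by
  refine le_trans ?_ (two_div_pi_mul_le_sin ht)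
  have : 1 / 2 ≤ 2 / Real.pi := by
    rw [div_le_div_iff₀ two_pos Real.pi_pos]; linarith [Real.pi_le_four]
  nlinarith [ht.1]

lemma sin_pos_of_mem {t : ℝ} (ht : t ∈ Set.Ioc 0 (Real.pi / 2)) : 0 < Real.sin t := by
  linarith [half_le_sin ht, ht.1]

lemma cos_nonneg_of_mem {t : ℝ} (ht : t ∈ Set.Ioc 0 (Real.pi / 2)) : 0 ≤ Real.cos t :=
  Real.cos_nonneg_of_mem_Icc ⟨by linarith [ht.1, Real.pi_pos], ht.2⟩

lemma integrableOn_walkIntegrand (n : ℕ) (a : ℝ) :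
    IntegrableOn (fun t => Real.cos t ^ n * (Real.sin (a * t) / Real.sin t))
      (Set.Ioc 0 (Real.pi / 2)) := by
  refine Measure.integrableOn_of_bounded (M := 2 * |a|) (by simp)
    (by fun_prop : Measurable _).aestronglyMeasurable ?_
  filter_upwards [ae_restrict_mem measurableSet_Ioc] with t ht
  have h1 := half_le_sin ht
  have h2 := sin_pos_of_mem ht
  rw [norm_mul, norm_pow, Real.norm_eq_abs, Real.norm_eq_abs, abs_div, abs_of_pos h2]
  have h3 : |Real.cos t| ^ n ≤ 1 := pow_le_one₀ (abs_nonneg _) (Real.abs_cos_le_one t)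
  have h4 : |Real.sin (a * t)| / Real.sin t ≤ 2 * |a| := by
    rw [div_le_iff₀ h2]
    calc |Real.sin (a * t)| ≤ |a * t| := Real.abs_sin_le_abs
      _ = |a| * t := by rw [abs_mul, abs_of_pos ht.1]
      _ ≤ 2 * |a| * Real.sin t := by nlinarith [abs_nonneg a]
  calc _ ≤ 1 * (|Real.sin (a * t)| / Real.sin t) := by gcongr
    _ ≤ _ := by simpa using h4

/-- The identity sin((a-1)t) + sin((a+1)t) = 2 sin(at) cos t supplies the extra cosine, so the
integral obeys the recursion that defines `walkCdf`. -/
lemma walkIntegral_succ (n : ℕ) (a : ℝ) :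
    walkIntegral (n + 1) a = (walkIntegral n (a - 1) + walkIntegral n (a + 1)) / 2 := by
  rw [walkIntegral, walkIntegral, walkIntegral, ← integral_add (integrableOn_walkIntegrand _ _)
    (integrableOn_walkIntegrand _ _), ← integral_div]
  congr with t
  have : Real.sin ((a - 1) * t) + Real.sin ((a + 1) * t) =
      2 * Real.sin (a * t) * Real.cos t := by
    rw [sub_mul, add_mul, one_mul, Real.sin_sub, Real.sin_add]; ring
  rw [← mul_add, ← add_div, this]
  ring

lemma walkIntegral_neg (n : ℕ) (a : ℝ) : walkIntegral n (-a) = -walkIntegral n a := by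
  rw [walkIntegral, walkIntegral, ← integral_neg]
  congr with t
  rw [neg_mul, Real.sin_neg]; ring

lemma walkIntegral_one (n : ℕ) :
    walkIntegral n 1 = ∫ t in Set.Ioc 0 (Real.pi / 2), Real.cos t ^ n := by
  refine setIntegral_congr_fun measurableSet_Ioc fun t ht => ?_
  simp [(sin_pos_of_mem ht).ne']

/-- Dirichlet kernel: passing from m to m + 1 changes the integrand by 2 cos((2m+2)t), whose
integral over (0, π/2) vanishes. -/
lemma walkIntegral_zero_odd (m : ℕ) : walkIntegral 0 (2 * m + 1) = Real.pi / 2 := by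
  induction m with
  | zero =>
    have h0 : 0 ≤ Real.pi / 2 := by positivity
    simp [walkIntegral_one, h0]
  | succ m ih =>
    rw [← ih, ← sub_eq_zero, walkIntegral, walkIntegral,
      ← integral_sub (integrableOn_walkIntegrand _ _) (integrableOn_walkIntegrand _ _)]
    have : ∀ t ∈ Set.Ioc 0 (Real.pi / 2),
        Real.cos t ^ 0 * (Real.sin ((2 * ((m + 1 : ℕ) : ℝ) + 1) * t) / Real.sin t) -
          Real.cos t ^ 0 * (Real.sin ((2 * (m : ℝ) + 1) * t) / Real.sin t) =
        2 * Real.cos ((2 * m + 2) * t) := fun t ht => by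
      have h1 := (sin_pos_of_mem ht).ne'
      have e1 : (2 * ((m + 1 : ℕ) : ℝ) + 1) * t = (2 * m + 2) * t + t := by push_cast; ring
      have e2 : (2 * (m : ℝ) + 1) * t = (2 * m + 2) * t - t := by ring
      rw [e1, e2, Real.sin_add, Real.sin_sub]
      field_simp
      ring
    rw [setIntegral_congr_fun measurableSet_Ioc this,
      ← intervalIntegral.integral_of_le (by positivity), intervalIntegral.integral_const_mul,
      intervalIntegral.integral_comp_mul_left (fun t => Real.cos t) (by positivity)]
    have h2 : Real.sin ((2 * (m : ℝ) + 2) * (Real.pi / 2)) = 0 := by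
      rw [show (2 * (m : ℝ) + 2) * (Real.pi / 2) = ((m + 1 : ℕ) : ℝ) * Real.pi by push_cast; ring]
      exact Real.sin_nat_mul_pi _
    simp [h2]

/-- The walk lives on n + 2ℤ. The argument of the integral is the midpoint between the last lattice
point n + 2⌊(x-n)/2⌋ not exceeding x and the next one. Both sides obey the same recursion in n; for
n = 0 the integral is ±π/2 according to the sign of an odd integer. -/
lemma walkCdf_eq (n : ℕ) (x : ℝ) :
    walkCdf n x = 1 / 2 + walkIntegral n (n + 1 + 2 * ⌊(x - n) / 2⌋) / Real.pi := by
  induction n generalizing x with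
  | zero =>
    rw [walkCdf]
    simp only [Nat.cast_zero, sub_zero, zero_add]
    have hpi := Real.pi_ne_zero
    split_ifs with hx
    · obtain ⟨m, hm⟩ := Int.eq_ofNat_of_zero_le (Int.floor_nonneg.2 (div_nonneg hx zero_le_two))
      rw [hm, Int.cast_natCast, add_comm, add_comm 1, walkIntegral_zero_odd]
      field_simp
      norm_num
    · have hlt : ⌊x / 2⌋ < 0 := Int.floor_lt.2 (by push_cast; linarith)
      obtain ⟨m, hm⟩ := Int.eq_ofNat_of_zero_le (show 0 ≤ -⌊x / 2⌋ - 1 by omega)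
      have e : (1 : ℝ) + 2 * (⌊x / 2⌋ : ℝ) = -(2 * (m : ℝ) + 1) := by
        rw [show ⌊x / 2⌋ = -(m : ℤ) - 1 by omega]; push_cast; ring
      rw [e, walkIntegral_neg, walkIntegral_zero_odd]
      field_simp
      norm_num
  | succ n ih =>
    have e1 : (x - 1 - n) / 2 = (x - (n + 1 : ℕ)) / 2 := by push_cast; ring
    have e2 : (x + 1 - n) / 2 = (x - (n + 1 : ℕ)) / 2 + 1 := by push_cast; ring
    rw [walkCdf, ih, ih, walkIntegral_succ, e1, e2, Int.floor_add_one]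
    push_cast
    ring_nf

lemma integral_mul_exp_neg_mul_sq {b : ℝ} (hb : 0 < b) :
    ∫ t in Set.Ioi (0 : ℝ), t * Real.exp (-b * t ^ 2) = (2 * b)⁻¹ := by
  have := integral_mul_cexp_neg_mul_sq (b := (b : ℂ)) (by simpa using hb)
  rw [← Complex.ofReal_inj, ← integral_complex_ofReal]
  push_cast
  exact this

lemma abs_cos_sub_exp_le (t : ℝ) : |Real.cos t - Real.exp (-t ^ 2 / 2)| ≤ t ^ 4 := by
  have h1 := Real.one_sub_sq_div_two_le_cos (x := t)
  have h2 : Real.cos t ≤ 1 - t ^ 2 / 2 + t ^ 4 := by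
    rcases le_total |t| 1 with h | h
    · have := (abs_le.1 (Real.cos_bound h)).2
      have h4 : |t| ^ 4 = t ^ 4 := by rw [← abs_pow]; exact abs_of_nonneg (by positivity)
      rw [h4] at this
      nlinarith [show 0 ≤ t ^ 4 by positivity]
    · have h3 : 1 ≤ t ^ 2 := by rwa [one_le_sq_iff_one_le_abs]
      nlinarith [Real.cos_le_one t]
  have h3 : 1 - t ^ 2 / 2 ≤ Real.exp (-t ^ 2 / 2) := by
    linarith [Real.add_one_le_exp (-t ^ 2 / 2)]
  have h4 : Real.exp (-t ^ 2 / 2) ≤ 1 - t ^ 2 / 2 + t ^ 4 := by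
    have h5 := Real.quadratic_le_exp_of_nonneg (show 0 ≤ t ^ 2 / 2 by positivity)
    rw [neg_div, Real.exp_neg, inv_le_iff_one_le_mul₀ (Real.exp_pos _)]
    set x := t ^ 2 / 2 with hx
    have hx0 : 0 ≤ x := by positivity
    have : t ^ 4 = 4 * x ^ 2 := by rw [hx]; ring
    rw [this]
    have h6 : 0 < 1 - x + 4 * x ^ 2 := by nlinarith [sq_nonneg (x - 1)]
    calc 1 ≤ (1 - x + 4 * x ^ 2) * (1 + x + x ^ 2 / 2) := by
          nlinarith [pow_nonneg hx0 3, pow_nonneg hx0 4, pow_nonneg hx0 2]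
      _ ≤ _ := by gcongr
  rw [abs_le]
  constructor <;> linarith

lemma cos_le_exp_neg {t : ℝ} (ht : t ∈ Set.Ioc 0 (Real.pi / 2)) :
    Real.cos t ≤ Real.exp (-t ^ 2 / 5) := by
  have h1 := Real.cos_le_one_sub_mul_cos_sq (x := t)
    (by rw [abs_of_pos ht.1]; linarith [ht.2, Real.pi_pos])
  have h2 : 1 / 5 ≤ 2 / Real.pi ^ 2 := by
    rw [div_le_div_iff₀ (by norm_num) (by positivity)]
    nlinarith [Real.pi_lt_d2, Real.pi_gt_three]
  have := Real.add_one_le_exp (-t ^ 2 / 5)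
  nlinarith [sq_nonneg t]

/-- The bound cos t ≤ exp(-t²/5) gives decay E² with E = exp(-nt²/10). One factor E absorbs nt²,
which comes from comparing the n-th powers; the other remains to make the majorant integrable. -/
lemma abs_walkIntegrand_sub_le {n : ℕ} (hn : 1 ≤ n) {t : ℝ} (ht : t ∈ Set.Ioc 0 (Real.pi / 2)) :
    |Real.cos t ^ n / Real.sin t - Real.exp (-n * t ^ 2 / 2) / t| ≤
      21 * (t * Real.exp (-(n / 10 : ℝ) * t ^ 2)) := by
  set E := Real.exp (-(n / 10 : ℝ) * t ^ 2) with hE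
  have hE0 : 0 < E := Real.exp_pos _
  have ht0 := ht.1
  have hs := sin_pos_of_mem ht
  have hc := cos_nonneg_of_mem ht
  have hM : Real.exp (-t ^ 2 / 5) ^ n = E * E := by
    rw [← Real.exp_nat_mul, ← Real.exp_add]; congr 1; ring
  have hE1 : E ≤ 1 := by
    rw [hE, Real.exp_le_one_iff, neg_mul]
    exact neg_nonpos.2 (by positivity)
  have hcE : Real.cos t ^ n ≤ E * E := by
    rw [← hM]; exact pow_le_pow_left₀ hc (cos_le_exp_neg ht) n
  have h1 : |1 / Real.sin t - 1 / t| ≤ t := by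
    have h := Real.abs_sub_sin_le t
    rw [abs_of_pos ht0] at h
    have h2 := half_le_sin ht
    rw [div_sub_div _ _ hs.ne' ht0.ne', abs_div, abs_of_pos (mul_pos hs ht0),
      div_le_iff₀ (mul_pos hs ht0)]
    calc |1 * t - Real.sin t * 1| ≤ t ^ 3 / 6 := by simpa using h
      _ ≤ t * (t / 2 * t) := by nlinarith [pow_pos ht0 3]
      _ ≤ t * (Real.sin t * t) := by gcongr
  have h2 : |Real.cos t ^ n - Real.exp (-n * t ^ 2 / 2)| ≤ t * (20 * (t * E)) := by
    have hexp : Real.exp (-n * t ^ 2 / 2) = Real.exp (-t ^ 2 / 2) ^ n := by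
      rw [← Real.exp_nat_mul]; congr 1; ring
    have hmax : max |Real.cos t| |Real.exp (-t ^ 2 / 2)| ≤ Real.exp (-t ^ 2 / 5) := by
      rw [abs_of_nonneg hc, Real.abs_exp]
      refine max_le (cos_le_exp_neg ht) (Real.exp_le_exp.2 ?_)
      nlinarith [sq_nonneg t]
    -- Lowering the exponent from n to n - 1 costs at most a factor 2, because t² ≤ 2.5 on this
    -- range.
    have hpow : Real.exp (-t ^ 2 / 5) ^ (n - 1) ≤ 2 * (E * E) := by
      rw [← hM]
      obtain ⟨m, rfl⟩ : ∃ m, n = m + 1 := ⟨n - 1, by omega⟩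
      rw [Nat.add_sub_cancel, pow_succ]
      have h3 : 1 / 2 ≤ Real.exp (-t ^ 2 / 5) := by
        have := Real.add_one_le_exp (-t ^ 2 / 5)
        have : t ^ 2 ≤ 2.5 := by nlinarith [ht.2, Real.pi_lt_d2, Real.pi_gt_three]
        linarith
      have h4 : ∀ p y : ℝ, 0 < p → 1 / 2 ≤ y → p ≤ 2 * (p * y) := fun p y _ _ => by nlinarith
      exact h4 _ _ (pow_pos (Real.exp_pos _) m) h3
    have hnE : n * t ^ 2 * E ≤ 10 := by
      have := Real.add_one_le_exp ((n / 10 : ℝ) * t ^ 2)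
      calc n * t ^ 2 * E ≤ 10 * Real.exp ((n / 10 : ℝ) * t ^ 2) * E :=
            mul_le_mul_of_nonneg_right (by linarith) hE0.le
        _ = 10 := by rw [hE, mul_assoc, ← Real.exp_add]; simp
    rw [hexp]
    calc _ ≤ |Real.cos t - Real.exp (-t ^ 2 / 2)| * n *
          max |Real.cos t| |Real.exp (-t ^ 2 / 2)| ^ (n - 1) := abs_pow_sub_pow_le _ _ _
      _ ≤ t ^ 4 * n * Real.exp (-t ^ 2 / 5) ^ (n - 1) := by
          gcongr; exact abs_cos_sub_exp_le t
      _ ≤ t ^ 4 * n * (2 * (E * E)) := by gcongr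
      _ = 2 * t ^ 2 * E * (n * t ^ 2 * E) := by ring
      _ ≤ 2 * t ^ 2 * E * 10 := by gcongr
      _ = _ := by ring
  have e : Real.cos t ^ n / Real.sin t - Real.exp (-n * t ^ 2 / 2) / t =
      Real.cos t ^ n * (1 / Real.sin t - 1 / t) +
        (Real.cos t ^ n - Real.exp (-n * t ^ 2 / 2)) / t := by ring
  rw [e]
  refine (abs_add_le _ _).trans ?_
  rw [abs_mul, abs_div, abs_of_pos ht0, abs_of_nonneg (pow_nonneg hc n)]
  have h5 : |Real.cos t ^ n - Real.exp (-n * t ^ 2 / 2)| / t ≤ 20 * (t * E) := by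
    rw [div_le_iff₀ ht0]; linarith
  have h6 : Real.cos t ^ n * |1 / Real.sin t - 1 / t| ≤ E * t := by
    have : Real.cos t ^ n ≤ E := hcE.trans (by nlinarith)
    gcongr
  linarith

/-- The majorant 21 t exp(-nt²/10) integrates to 105/n. Beyond π/2 only the Gaussian integrand is
left, and since t ≥ 1 there the same majorant covers it. -/
lemma abs_walkIntegral_sub_le {n : ℕ} (hn : 1 ≤ n) (a : ℝ) :
    |walkIntegral n a - Real.pi * (Φ (a / √n) - 1 / 2)| ≤ 105 / n := by
  have hn0 : (0 : ℝ) < n := by exact_mod_cast hn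
  rw [← integral_exp_mul_sin_div hn0, walkIntegral]
  have hsub : Set.Ioc 0 (Real.pi / 2) = Set.Ioi 0 ∩ Set.Iic (Real.pi / 2) := by ext; simp
  have hI := integrableOn_walkIntegrand n a
  rw [hsub, ← setIntegral_indicator measurableSet_Iic]
  have hb : 0 < (n / 10 : ℝ) := by positivity
  have hJ : IntegrableOn (fun t : ℝ => t * Real.exp (-(n / 10 : ℝ) * t ^ 2)) (Set.Ioi 0) :=
    (integrable_mul_exp_neg_mul_sq hb).integrableOn
  have hG : IntegrableOn (fun t : ℝ => Real.exp (-n * t ^ 2 / 2) * (Real.sin (a * t) / t))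
      (Set.Ioi 0) := by
    have := (integrable_exp_neg_mul_sq (half_pos hn0)).const_mul |a|
    refine this.integrableOn.mono' (by fun_prop : Measurable _).aestronglyMeasurable ?_
    filter_upwards [ae_restrict_mem measurableSet_Ioi] with t ht
    have ht : 0 < t := ht
    rw [norm_mul, mul_comm, Real.norm_eq_abs, Real.norm_eq_abs, Real.abs_exp]
    refine mul_le_mul ?_ (by apply le_of_eq; congr 1; ring) (Real.exp_pos _).le (abs_nonneg a)
    rw [abs_div, div_le_iff₀ (abs_pos.2 ht.ne'), ← abs_mul]
    exact Real.abs_sin_le_abs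
  rw [← integral_sub ?_ hG, ← Real.norm_eq_abs]
  · refine (norm_integral_le_of_norm_le (hJ.const_mul 21) ?_).trans ?_
    · filter_upwards [ae_restrict_mem measurableSet_Ioi] with t ht
      have ht : 0 < t := ht
      by_cases h : t ≤ Real.pi / 2
      · rw [Set.indicator_of_mem (show t ∈ Set.Iic (Real.pi / 2) from h)]
        have e : Real.cos t ^ n * (Real.sin (a * t) / Real.sin t) -
            Real.exp (-n * t ^ 2 / 2) * (Real.sin (a * t) / t) = Real.sin (a * t) *
            (Real.cos t ^ n / Real.sin t - Real.exp (-n * t ^ 2 / 2) / t) := by ring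
        rw [e, norm_mul]
        refine le_trans ?_ (abs_walkIntegrand_sub_le hn ⟨ht, h⟩)
        exact mul_le_of_le_one_left (norm_nonneg _) (Real.abs_sin_le_one _)
      · rw [Set.indicator_of_notMem (show t ∉ Set.Iic (Real.pi / 2) from h), zero_sub, norm_neg,
          norm_mul, Real.norm_eq_abs, Real.abs_exp, mul_comm]
        have h1 : 1 ≤ t := by linarith [Real.pi_gt_three]
        have h2 : ‖Real.sin (a * t) / t‖ ≤ t := by
          rw [norm_div, Real.norm_eq_abs, Real.norm_eq_abs, abs_of_pos ht, div_le_iff₀ ht]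
          nlinarith [Real.abs_sin_le_one (a * t)]
        have h3 : Real.exp (-n * t ^ 2 / 2) ≤ Real.exp (-(n / 10 : ℝ) * t ^ 2) := by
          apply Real.exp_le_exp.2
          nlinarith [mul_pos hn0 (pow_pos ht 2)]
        have h4 := mul_le_mul h2 h3 (Real.exp_pos _).le ht.le
        have h5 : 0 < t * Real.exp (-(n / 10 : ℝ) * t ^ 2) := by positivity
        linarith
    · rw [integral_const_mul, integral_mul_exp_neg_mul_sq hb]
      apply le_of_eq
      field_simp
      norm_num
  · rw [integrable_indicator_iff measurableSet_Iic, IntegrableOn,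
      Measure.restrict_restrict measurableSet_Iic, Set.inter_comm, ← hsub]
    exact hI

/-- The sawtooth function `1/2 - {u}`. -/
noncomputable def sawtooth (u : ℝ) : ℝ := 1 / 2 - Int.fract u

lemma abs_sawtooth_le (u : ℝ) : |sawtooth u| ≤ 1 / 2 := by
  rw [sawtooth, abs_le]
  constructor <;> linarith [Int.fract_nonneg u, Int.fract_lt_one u]

lemma measurable_sawtooth : Measurable sawtooth := measurable_const.sub measurable_fract

/-- Edgeworth expansion of the simple random walk, uniform in `w`. -/
lemma abs_walkCdf_sub_le {n : ℕ} (hn : 1 ≤ n) (w : ℝ) :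
    |walkCdf n (w * √n) - (Φ w + φ w * (2 / √n * sawtooth ((w * √n - n) / 2)))| ≤ 106 / n := by
  have hn0 : (0 : ℝ) < n := by exact_mod_cast hn
  have hs : 0 < √(n : ℝ) := Real.sqrt_pos.2 hn0
  set u := (w * √n - n) / 2 with hu
  -- Since 1 + 2⌊u⌋ = 2u + 2(1/2 - {u}), the lattice effect is a shift of the argument by twice a
  -- sawtooth, i.e. a shift of w by O(n^(-1/2)), ready for Taylor expansion.
  have ha : (n : ℝ) + 1 + 2 * ⌊u⌋ = w * √n + 2 * sawtooth u := by
    rw [sawtooth, Int.fract, hu]; ring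
  rw [walkCdf_eq, ha]
  have h1 := abs_walkIntegral_sub_le hn (w * √n + 2 * sawtooth u)
  have e : (w * √n + 2 * sawtooth u) / √n = w + 2 / √n * sawtooth u := by field_simp
  rw [e] at h1
  have h2 := abs_stdCdf_sub_taylor_le w (2 / √n * sawtooth u)
  have h3 : (2 / √n * sawtooth u) ^ 2 ≤ 1 / n := by
    have := abs_le.1 (abs_sawtooth_le u)
    rw [mul_pow, div_pow, Real.sq_sqrt hn0.le, div_mul_eq_mul_div]
    gcongr
    nlinarith
  set W := walkIntegral n (w * √n + 2 * sawtooth u)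
  set D := Φ (w + 2 / √n * sawtooth u)
  have h4 : |1 / 2 + W / Real.pi - D| ≤ 105 / n := by
    have e2 : 1 / 2 + W / Real.pi - D = (W - Real.pi * (D - 1 / 2)) / Real.pi := by
      field_simp; ring
    rw [e2, abs_div, abs_of_pos Real.pi_pos]
    refine (div_le_self (abs_nonneg _) (by linarith [Real.pi_gt_three])).trans h1
  have h5 : (106 : ℝ) / n = 105 / n + 1 / n := by ring
  rw [h5, abs_le]
  rw [abs_le] at h2 h4
  constructor <;> linarith

/-! ### Binomial averages -/

/-- The binomial weights with success probability `2/3`. -/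
noncomputable def binWeight (N n : ℕ) : ℝ := N.choose n * 2 ^ n / 3 ^ N

lemma binWeight_nonneg (N n : ℕ) : 0 ≤ binWeight N n := by unfold binWeight; positivity

/-- The average of `a` under the binomial distribution with parameters `N` and `2/3`. -/
noncomputable def binMean (N : ℕ) (a : ℕ → ℝ) : ℝ :=
  ∑ n ∈ Finset.range (N + 1), binWeight N n * a n

lemma binMean_zero (a : ℕ → ℝ) : binMean 0 a = a 0 := by simp [binMean, binWeight]

/-- Conditioning on one trial, in the form of Pascal's rule; the later binomial identities are
inductions on this. -/
lemma binMean_succ (N : ℕ) (a : ℕ → ℝ) :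
    binMean (N + 1) a = (2 * binMean N (fun n => a (n + 1)) + binMean N a) / 3 := by
  have h1 : ∀ n, binWeight (N + 1) (n + 1) = (2 * binWeight N n + binWeight N (n + 1)) / 3 := by
    intro n
    simp only [binWeight, Nat.choose_succ_succ, Nat.succ_eq_add_one]
    push_cast
    rw [pow_succ 3 N]
    field_simp
    ring
  have h2 : binWeight (N + 1) 0 = binWeight N 0 / 3 := by
    simp only [binWeight, Nat.choose_zero_right]; rw [pow_succ 3 N]; field_simp
  have h3 : binMean N a = ∑ n ∈ Finset.range (N + 2), binWeight N n * a n := by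
    rw [Finset.sum_range_succ]; simp [binMean, binWeight]
  rw [h3, Finset.sum_range_succ', binMean, Finset.sum_range_succ', binMean, h2]
  simp_rw [h1]
  rw [show ∑ n ∈ Finset.range (N + 1),
      (2 * binWeight N n + binWeight N (n + 1)) / 3 * a (n + 1) =
      (2 * ∑ n ∈ Finset.range (N + 1), binWeight N n * a (n + 1) +
        ∑ n ∈ Finset.range (N + 1), binWeight N (n + 1) * a (n + 1)) / 3 by
    rw [Finset.mul_sum, ← Finset.sum_add_distrib, Finset.sum_div]
    exact Finset.sum_congr rfl fun n _ => by ring]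
  ring

lemma binMean_add (N : ℕ) (a b : ℕ → ℝ) :
    binMean N (fun n => a n + b n) = binMean N a + binMean N b := by
  simp [binMean, mul_add, Finset.sum_add_distrib]

lemma binMean_sub (N : ℕ) (a b : ℕ → ℝ) :
    binMean N (fun n => a n - b n) = binMean N a - binMean N b := by
  simp [binMean, mul_sub, Finset.sum_sub_distrib]

lemma binMean_const_mul (N : ℕ) (c : ℝ) (a : ℕ → ℝ) :
    binMean N (fun n => c * a n) = c * binMean N a := by
  simp only [binMean, Finset.mul_sum]
  exact Finset.sum_congr rfl fun n _ => by ring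

lemma binMean_const (N : ℕ) (c : ℝ) : binMean N (fun _ => c) = c := by
  induction N with
  | zero => rw [binMean_zero]
  | succ N ih => rw [binMean_succ, ih]; ring

lemma binMean_pow (N : ℕ) (z : ℝ) : binMean N (fun n => z ^ n) = ((1 + 2 * z) / 3) ^ N := by
  induction N with
  | zero => simp [binMean_zero]
  | succ N ih =>
    have : binMean N (fun n => z ^ (n + 1)) = z * binMean N (fun n => z ^ n) := by
      rw [← binMean_const_mul]; simp_rw [pow_succ']
    rw [binMean_succ, this, ih]; ring

lemma binMean_sub_sq (N : ℕ) (c : ℝ) :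
    binMean N (fun n => ((n : ℝ) - c) ^ 2) = 2 * N / 9 + (2 * N / 3 - c) ^ 2 := by
  induction N generalizing c with
  | zero => simp [binMean_zero]
  | succ N ih =>
    have : (fun n : ℕ => (((n + 1 : ℕ) : ℝ) - c) ^ 2) = fun n : ℕ => ((n : ℝ) - (c - 1)) ^ 2 := by
      ext n; push_cast; ring
    rw [binMean_succ, this, ih, ih]; push_cast; ring

lemma binMean_mono {N : ℕ} {a b : ℕ → ℝ} (h : ∀ n ≤ N, a n ≤ b n) : binMean N a ≤ binMean N b :=
  Finset.sum_le_sum fun n hn => mul_le_mul_of_nonneg_left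
    (h n (Nat.lt_succ_iff.1 (Finset.mem_range.1 hn))) (binWeight_nonneg N n)

lemma abs_binMean_le (N : ℕ) (a : ℕ → ℝ) : |binMean N a| ≤ binMean N (fun n => |a n|) := by
  refine (Finset.abs_sum_le_sum_abs _ _).trans_eq (Finset.sum_congr rfl fun n _ => ?_)
  rw [abs_mul, abs_of_nonneg (binWeight_nonneg N n)]

/-- Chebyshev-type bound: averages of quantities with a quadratic majorant. -/
lemma abs_binMean_le_of_quadratic {N : ℕ} {a : ℕ → ℝ} {α β : ℝ}
    (h : ∀ n ≤ N, |a n| ≤ α + β * ((n : ℝ) - 2 * N / 3) ^ 2) :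
    |binMean N a| ≤ α + β * (2 * N / 9) := by
  refine (abs_binMean_le N a).trans ((binMean_mono h).trans_eq ?_)
  rw [binMean_add, binMean_const, binMean_const_mul, binMean_sub_sq]
  ring

/-! ### The law of the self-normalized sum -/

/-- The mixture of random walk distribution functions which represents `distFun`. -/
noncomputable def mixCdf (N : ℕ) (w : ℝ) : ℝ := binMean N fun n => walkCdf n (w * √n)

instance isProbabilityMeasure_stepLaw : IsProbabilityMeasure stepLaw := by
  constructor
  simp only [stepLaw, Measure.smul_apply, Measure.add_apply, measure_univ, smul_eq_mul]
  rw [show (1 : ENNReal) + 1 + 1 = 3 by norm_num]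
  exact ENNReal.inv_mul_cancel (by norm_num) (by norm_num)

lemma lintegral_stepLaw {f : ℝ → ENNReal} (hf : Measurable f) :
    ∫⁻ x, f x ∂stepLaw = 3⁻¹ * (f (-1) + f 0 + f 1) := by
  simp only [stepLaw, lintegral_smul_measure, lintegral_add_measure, smul_eq_mul]
  rw [lintegral_dirac' _ hf, lintegral_dirac' _ hf, lintegral_dirac' _ hf]

/-- The offsets s and q record the sum and the sum of squares of the coordinates already revealed,
so that conditioning on one more coordinate stays within the same family of events. -/
lemma pi_stepLaw_real_succ (N : ℕ) (s q w : ℝ) :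
    (Measure.pi fun _ : Fin (N + 1) => stepLaw).real
        {x | s + ∑ i, x i ≤ w * √(q + ∑ i, x i ^ 2)} =
      ((Measure.pi fun _ : Fin N => stepLaw).real
          {x | s - 1 + ∑ i, x i ≤ w * √(q + 1 + ∑ i, x i ^ 2)} +
        (Measure.pi fun _ : Fin N => stepLaw).real {x | s + ∑ i, x i ≤ w * √(q + ∑ i, x i ^ 2)} +
        (Measure.pi fun _ : Fin N => stepLaw).real
          {x | s + 1 + ∑ i, x i ≤ w * √(q + 1 + ∑ i, x i ^ 2)}) / 3 := by
  have hmp := measurePreserving_piFinSuccAbove (fun _ : Fin (N + 1) => stepLaw) 0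
  set S : Set (ℝ × (Fin N → ℝ)) :=
    {z | s + (z.1 + ∑ i, z.2 i) ≤ w * √(q + (z.1 ^ 2 + ∑ i, z.2 i ^ 2))} with hS
  have hSm : MeasurableSet S := measurableSet_le (by fun_prop) (by fun_prop)
  have hpre : {x : Fin (N + 1) → ℝ | s + ∑ i, x i ≤ w * √(q + ∑ i, x i ^ 2)} =
      MeasurableEquiv.piFinSuccAbove (fun _ : Fin (N + 1) => ℝ) 0 ⁻¹' S := by
    ext x
    simp [hS, Fin.sum_univ_succ, MeasurableEquiv.piFinSuccAbove, Fin.tail]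
  have key : (Measure.pi fun _ : Fin (N + 1) => stepLaw)
      {x | s + ∑ i, x i ≤ w * √(q + ∑ i, x i ^ 2)} =
      3⁻¹ * ((Measure.pi fun _ : Fin N => stepLaw)
          {x | s - 1 + ∑ i, x i ≤ w * √(q + 1 + ∑ i, x i ^ 2)} +
        (Measure.pi fun _ : Fin N => stepLaw) {x | s + ∑ i, x i ≤ w * √(q + ∑ i, x i ^ 2)} +
        (Measure.pi fun _ : Fin N => stepLaw)
          {x | s + 1 + ∑ i, x i ≤ w * √(q + 1 + ∑ i, x i ^ 2)}) := by
    rw [hpre, hmp.measure_preimage hSm.nullMeasurableSet, Measure.prod_apply hSm,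
      lintegral_stepLaw (measurable_measure_prodMk_left hSm)]
    congr 4 <;> ext x <;> simp [hS, ← add_assoc, sub_eq_add_neg]
  rw [measureReal_def, key, ENNReal.toReal_mul, ENNReal.toReal_add (by finiteness) (by finiteness),
    ENNReal.toReal_add (by finiteness) (by finiteness)]
  simp only [measureReal_def]
  simp
  ring

/-- A zero coordinate changes neither offset; the values ±1 raise q by one and together perform one
step of the `walkCdf` recursion. The binomial index thus counts the nonzero coordinates. -/
lemma pi_stepLaw_real_eq (N : ℕ) (s q w : ℝ) :
    (Measure.pi fun _ : Fin N => stepLaw).real {x | s + ∑ i, x i ≤ w * √(q + ∑ i, x i ^ 2)} =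
      binMean N fun n => walkCdf n (w * √(q + n) - s) := by
  induction N generalizing s q with
  | zero =>
    rw [binMean_zero, walkCdf]
    by_cases h : s ≤ w * √q <;> simp [h]
  | succ N ih =>
    rw [pi_stepLaw_real_succ, ih, ih, ih, binMean_succ, ← binMean_const_mul]
    congr 1
    rw [add_right_comm, ← binMean_add]
    congr 1
    congr 1
    ext n
    rw [walkCdf]
    push_cast
    rw [add_right_comm q 1, ← add_assoc]
    ring_nf

/-- Clearing the denominator is valid unless all coordinates vanish. Then the cleared inequality 0 ≤
0 always holds while W_N = 0 ≤ w needs w ≥ 0, hence the restriction on w. -/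
lemma distFun_eq (N : ℕ) {w : ℝ} (hw : 0 ≤ w) : distFun N w = mixCdf N w := by
  have h := pi_stepLaw_real_eq N 0 0 w
  simp only [zero_add, sub_zero] at h
  rw [mixCdf, ← h, distFun]
  congr 1
  ext x
  simp only [selfNormalizedSum, Set.mem_ofPred_eq]
  have h0 : 0 ≤ ∑ i, x i ^ 2 := Finset.sum_nonneg fun i _ => sq_nonneg _
  rcases h0.eq_or_lt with h0 | h0
  · have h1 : ∀ i, x i = 0 := fun i => by
      have := (Finset.sum_eq_zero_iff_of_nonneg (fun i _ => sq_nonneg (x i))).1 h0.symm i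
        (Finset.mem_univ i)
      simpa using this
    simp [h1, hw]
  · rw [div_le_iff₀ (Real.sqrt_pos.2 h0)]

lemma mixCdf_mem_Icc (N : ℕ) (w : ℝ) : mixCdf N w ∈ Set.Icc 0 1 := by
  constructor
  · rw [← binMean_const N 0]
    exact binMean_mono fun n _ => (walkCdf_mem_Icc _ _).1
  · rw [← binMean_const N 1]
    exact binMean_mono fun n _ => (walkCdf_mem_Icc _ _).2

lemma abs_mixCdf_sub_le_one (N : ℕ) (w : ℝ) : |mixCdf N w - Φ w| ≤ 1 := by
  have h1 := mixCdf_mem_Icc N w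
  rw [abs_le]
  constructor <;> linarith [h1.1, h1.2, cdf_nonneg (gaussianReal 0 1) w,
    cdf_le_one (gaussianReal 0 1) w]

lemma abs_mixCdf_sub_le_normalApproxError (N : ℕ) {w : ℝ} (hw : 0 < w) :
    |mixCdf N w - Φ w| ≤ normalApproxError N := by
  rw [← distFun_eq N hw.le]
  refine le_ciSup (f := fun w : Set.Ioi (0 : ℝ) => |distFun N w - Φ w|) ⟨1, ?_⟩ ⟨w, hw⟩
  rintro _ ⟨⟨v, hv⟩, rfl⟩
  simp only
  rw [distFun_eq N (le_of_lt hv)]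
  exact abs_mixCdf_sub_le_one N v

lemma distFun_mono (N : ℕ) : Monotone (distFun N) := fun _ _ h =>
  measureReal_mono fun _ hx => le_trans hx h

/-- The supremum runs over w > 0 only, so the origin is reached as a limit: F_N(0) ≤ F_N(w) by
monotonicity, and Φ(w) → 1/2 as w ↓ 0. -/
lemma mixCdf_zero_sub_le_normalApproxError (N : ℕ) : mixCdf N 0 - 1 / 2 ≤ normalApproxError N := by
  have h1 : Filter.Tendsto (fun w => mixCdf N 0 - Φ w) (nhdsWithin 0 (Set.Ioi 0))
      (nhds (mixCdf N 0 - Φ 0)) :=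
    ((hasDerivAt_stdCdf 0).continuousAt.tendsto.mono_left nhdsWithin_le_nhds).const_sub _
  rw [← stdCdf_zero]
  refine le_of_tendsto h1 ?_
  filter_upwards [self_mem_nhdsWithin] with w hw
  refine le_trans ?_ (abs_mixCdf_sub_le_normalApproxError N hw)
  refine le_trans (sub_le_sub_right ?_ _) (le_abs_self _)
  rw [← distFun_eq N le_rfl, ← distFun_eq N (le_of_lt hw)]
  exact distFun_mono N (le_of_lt hw)

/-! ### Lower bound from the jump at the origin -/

/-- On 0 < t ≤ (n+1)^(-1/2) Bernoulli's inequality gives cos(t)^n ≥ 1/2; the rest of the integrand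
is nonnegative. -/
lemma inv_sqrt_le_walkIntegral_one (n : ℕ) : 1 / (2 * √(n + 1)) ≤ walkIntegral n 1 := by
  rw [walkIntegral_one]
  set δ := 1 / √((n : ℝ) + 1) with hδ
  have hδ0 : 0 < δ := by positivity
  have hδ1 : δ ≤ 1 := by
    rw [hδ, div_le_one (by positivity), Real.one_le_sqrt]; linarith [n.cast_nonneg (α := ℝ)]
  have hδsq : δ ^ 2 = 1 / ((n : ℝ) + 1) := by
    rw [hδ, div_pow, Real.sq_sqrt (by positivity), one_pow]
  have hsub : Set.Ioc 0 δ ⊆ Set.Ioc 0 (Real.pi / 2) :=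
    Set.Ioc_subset_Ioc_right (by linarith [Real.pi_gt_three])
  have hint : IntegrableOn (fun t => Real.cos t ^ n) (Set.Ioc 0 (Real.pi / 2)) :=
    (Continuous.integrableOn_Icc (by fun_prop)).mono_set Set.Ioc_subset_Icc_self
  calc 1 / (2 * √((n : ℝ) + 1)) = ∫ _ in Set.Ioc 0 δ, (1 / 2 : ℝ) := by
        rw [setIntegral_const, smul_eq_mul, Real.volume_real_Ioc_of_le hδ0.le, hδ]; field_simp; simp
    _ ≤ ∫ t in Set.Ioc 0 δ, Real.cos t ^ n := by
        refine setIntegral_mono_on (by simp) (hint.mono_set hsub) measurableSet_Ioc fun t ht => ?_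
        have h1 := Real.one_sub_sq_div_two_le_cos (x := t)
        have h2 : t ^ 2 ≤ 1 / ((n : ℝ) + 1) := by rw [← hδsq]; exact pow_le_pow_left₀ ht.1.le ht.2 2
        have h3 : t ^ 2 ≤ 1 := h2.trans (by rw [hδsq.symm]; exact pow_le_one₀ hδ0.le hδ1)
        have h4 := one_add_mul_le_pow (a := -(t ^ 2 / 2)) (by linarith) n
        have h5 : n * t ^ 2 ≤ 1 := by
          rw [le_div_iff₀ (by positivity)] at h2
          nlinarith [sq_nonneg t]
        calc (1 / 2 : ℝ) ≤ 1 + n * -(t ^ 2 / 2) := by linarith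
          _ ≤ (1 + -(t ^ 2 / 2)) ^ n := h4
          _ ≤ _ := pow_le_pow_left₀ (by linarith) (by linarith) n
    _ ≤ _ := by
        refine setIntegral_mono_set hint ?_ hsub.eventuallyLE
        filter_upwards [ae_restrict_mem measurableSet_Ioc] with t ht
        exact pow_nonneg (cos_nonneg_of_mem ht) n

/-- By symmetry the excess over 1/2 is half the atom at 0, present only for even n. Parity is
encoded through (-1)^n so that its binomial mean follows from `binMean_pow` at z = -1. -/
lemma le_walkCdf_zero (n : ℕ) :
    1 / 2 + (1 + (-1) ^ n) / 2 * (1 / (2 * Real.pi * √(n + 1))) ≤ walkCdf n 0 := by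
  rw [walkCdf_eq]
  rcases Nat.even_or_odd' n with ⟨m, rfl | rfl⟩
  · have h : ⌊(0 - ((2 * m : ℕ) : ℝ)) / 2⌋ = -(m : ℤ) := by
      rw [show (0 - ((2 * m : ℕ) : ℝ)) / 2 = ((-(m : ℤ) : ℤ) : ℝ) by push_cast; ring,
        Int.floor_intCast]
    have h1 := inv_sqrt_le_walkIntegral_one (2 * m)
    have e : ((2 * m : ℕ) : ℝ) + 1 + 2 * ((-(m : ℤ) : ℤ) : ℝ) = 1 := by push_cast; ring
    rw [h, e, pow_mul, neg_one_sq, one_pow]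
    have h2 := div_le_div_of_nonneg_right h1 Real.pi_pos.le
    calc _ = 1 / 2 + 1 / (2 * √(((2 * m : ℕ) : ℝ) + 1)) / Real.pi := by field_simp; ring
      _ ≤ _ := by linarith
  · have h : ⌊(0 - ((2 * m + 1 : ℕ) : ℝ)) / 2⌋ = -(m : ℤ) - 1 := by
      rw [Int.floor_eq_iff]; push_cast; constructor <;> linarith
    have e : ((2 * m + 1 : ℕ) : ℝ) + 1 + 2 * ((-(m : ℤ) - 1 : ℤ) : ℝ) = 0 := by push_cast; ring
    rw [h, e, pow_succ, pow_mul, neg_one_sq, one_pow]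
    simp [walkIntegral]

lemma inv_sqrt_le_normalApproxError {N : ℕ} (hN : 0 < N) :
    1 / 30 / √N ≤ normalApproxError N := by
  refine le_trans ?_ (mixCdf_zero_sub_le_normalApproxError N)
  have hN1 : (1 : ℝ) ≤ N := by exact_mod_cast hN
  set κ := 1 / (2 * Real.pi * √((N : ℝ) + 1)) with hκ
  have hκ0 : 0 < κ := by positivity
  have h1 : 1 / 2 + (1 + (-1 / 3) ^ N) / 2 * κ ≤ mixCdf N 0 := by
    have e : binMean N (fun n => 1 / 2 + (κ / 2 + κ / 2 * (-1) ^ n)) =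
        1 / 2 + (1 + (-1 / 3) ^ N) / 2 * κ := by
      rw [binMean_add, binMean_add, binMean_const, binMean_const, binMean_const_mul, binMean_pow]
      norm_num
      ring
    rw [← e]
    refine binMean_mono fun n hn => ?_
    rw [zero_mul]
    refine le_trans ?_ (le_walkCdf_zero n)
    have h2 : κ ≤ 1 / (2 * Real.pi * √((n : ℝ) + 1)) := by
      rw [hκ]; gcongr
    have h3 : (0 : ℝ) ≤ (1 + (-1) ^ n) / 2 := by
      rcases neg_one_pow_eq_or ℝ n with h | h <;> rw [h] <;> norm_num
    nlinarith
  -- The parity factor (1 + (-1/3)^N)/2 is therefore at least 1/3, the worst case being N = 1.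
  have h2 : (-1 / 3 : ℝ) ^ N ≥ -(1 / 3) := by
    have : |(-1 / 3 : ℝ) ^ N| ≤ 1 / 3 := by
      rw [abs_pow, abs_div, abs_neg, abs_one, abs_of_pos (by norm_num : (0 : ℝ) < 3)]
      exact pow_le_of_le_one (by norm_num) (by norm_num) hN.ne'
    exact (abs_le.1 this).1
  have h3 : 1 / 30 / √N ≤ κ / 3 := by
    rw [hκ, div_div, div_div, div_le_div_iff₀ (by positivity) (by positivity)]
    have h4 : √((N : ℝ) + 1) ≤ 1.5 * √N := by
      rw [Real.sqrt_le_left (by positivity), mul_pow, Real.sq_sqrt (by positivity)]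
      linarith
    nlinarith [Real.pi_lt_d2, Real.pi_pos, Real.sqrt_pos.2 (show (0 : ℝ) < N by linarith)]
  nlinarith

/-! ### Averaging the expansion of the random walk -/

lemma sqrt_six_le : √(6 : ℝ) ≤ 2.5 := by rw [Real.sqrt_le_left (by norm_num)]; norm_num

/-- If n < N/6, then n misses the mean 2N/3 by more than N/2. On this rare range trivial bounds are
charged to the quadratic term, whose binomial mean is O(1/N). -/
lemma sixth_le_or_sq_le {N : ℕ} (hN : 0 < N) (n : ℕ) :
    (N : ℝ) / 6 ≤ n ∨ 1 ≤ 4 / (N : ℝ) ^ 2 * ((n : ℝ) - 2 * N / 3) ^ 2 := by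
  have hN1 : (0 : ℝ) < N := by exact_mod_cast hN
  rcases le_or_gt ((N : ℝ) / 6) n with h | h
  · exact Or.inl h
  · right
    rw [div_mul_eq_mul_div, le_div_iff₀ (by positivity)]
    nlinarith

/-- Here √6/√N is the value of 2/√n at n = 2N/3. The first-order error |n - 2N/3|/N^(3/2) is split
by AM-GM into 1/N plus a quadratic term, so that only the variance is needed on averaging. -/
lemma abs_inv_sqrt_sub_le {N : ℕ} (hN : 0 < N) {n : ℕ} (hn : (N : ℝ) / 6 ≤ n) :
    |2 / √n - √6 / √N| ≤ 4 / N + 4 / (N : ℝ) ^ 2 * ((n : ℝ) - 2 * N / 3) ^ 2 := by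
  have hN1 : (0 : ℝ) < N := by exact_mod_cast hN
  have hn1 : (0 : ℝ) < n := by linarith
  have a0 : 0 < √(N : ℝ) := Real.sqrt_pos.2 hN1
  have b0 : 0 < √(n : ℝ) := Real.sqrt_pos.2 hn1
  have a2 : √(N : ℝ) ^ 2 = N := Real.sq_sqrt hN1.le
  have b2 : √(n : ℝ) ^ 2 = n := Real.sq_sqrt hn1.le
  have s2 : √(6 : ℝ) ^ 2 = 6 := Real.sq_sqrt (by norm_num)
  have s0 : 0 < √(6 : ℝ) := by positivity
  have s1 := sqrt_six_le
  generalize √(N : ℝ) = a at *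
  generalize √(n : ℝ) = b at *
  generalize √(6 : ℝ) = s at *
  rw [← a2, ← b2]
  rw [← a2, ← b2] at hn
  have hab : a ≤ s * b := by
    by_contra! h
    nlinarith [mul_pos s0 b0]
  have e : 2 / b - s / a = (4 * a ^ 2 - 6 * b ^ 2) / (a * b * (2 * a + s * b)) := by
    rw [← s2]; field_simp; ring
  have h1 : |2 / b - s / a| ≤ 6 * (|b ^ 2 - 2 * a ^ 2 / 3| / a ^ 3) := by
    rw [e, abs_div, abs_of_pos (by positivity : 0 < a * b * (2 * a + s * b)),
      show 4 * a ^ 2 - 6 * b ^ 2 = -6 * (b ^ 2 - 2 * a ^ 2 / 3) by ring, abs_mul,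
      ← mul_div_assoc, div_le_div_iff₀ (by positivity) (by positivity)]
    have : a ^ 3 ≤ a * b * (2 * a + s * b) := by
      have : a ^ 2 ≤ b * (2 * a + s * b) := by nlinarith
      nlinarith
    norm_num
    have := mul_le_mul_of_nonneg_left this (abs_nonneg (b ^ 2 - 2 * a ^ 2 / 3))
    nlinarith
  have h2 : |b ^ 2 - 2 * a ^ 2 / 3| / a ^ 3 ≤
      (1 / 2) * (1 / a ^ 2 + 1 / (a ^ 2) ^ 2 * (b ^ 2 - 2 * a ^ 2 / 3) ^ 2) := by
    rw [← sq_abs (b ^ 2 - 2 * a ^ 2 / 3)]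
    generalize |b ^ 2 - 2 * a ^ 2 / 3| = y
    have : (1 / 2) * (1 / a ^ 2 + 1 / (a ^ 2) ^ 2 * y ^ 2) - y / a ^ 3 =
        (1 / 2) * (1 / a - y / a ^ 2) ^ 2 := by field_simp; ring
    have := sq_nonneg (1 / a - y / a ^ 2)
    linarith
  have h3 : 0 ≤ 1 / a ^ 2 := by positivity
  have h4 : 0 ≤ 1 / (a ^ 2) ^ 2 * (b ^ 2 - 2 * a ^ 2 / 3) ^ 2 := by positivity
  calc _ ≤ 3 * (1 / a ^ 2 + 1 / (a ^ 2) ^ 2 * (b ^ 2 - 2 * a ^ 2 / 3) ^ 2) := by linarith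
    _ ≤ 4 * (1 / a ^ 2 + 1 / (a ^ 2) ^ 2 * (b ^ 2 - 2 * a ^ 2 / 3) ^ 2) := by linarith
    _ = _ := by ring

lemma abs_mixCdf_sub_sub_le {N : ℕ} (hN : 0 < N) (w : ℝ) :
    |mixCdf N w - Φ w -
      φ w * (√6 / √N) * binMean N (fun n => sawtooth ((w * √n - n) / 2))| ≤ 900 / N := by
  have hN1 : (1 : ℝ) ≤ N := by exact_mod_cast hN
  rw [mixCdf, ← binMean_const N (Φ w), ← binMean_sub, ← binMean_const_mul, ← binMean_sub]
  refine (abs_binMean_le_of_quadratic (α := 700 / N) (β := 700 / (N : ℝ) ^ 2) fun n _ => ?_).trans ?_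
  · set u := (w * √n - n) / 2
    have hφ0 := stdPDF_nonneg w
    have hφ1 := stdPDF_le_one w
    have hsaw := abs_sawtooth_le u
    have hs6 : √6 / √(N : ℝ) ≤ 2.5 := by
      have s1 := sqrt_six_le
      refine (div_le_self (by positivity) ?_).trans s1
      exact Real.one_le_sqrt.2 hN1
    have hs60 : 0 ≤ √6 / √(N : ℝ) := by positivity
    have hα : 0 ≤ 1 / (N : ℝ) := by positivity
    have hβ : 0 ≤ 1 / (N : ℝ) ^ 2 * ((n : ℝ) - 2 * N / 3) ^ 2 := by positivity
    have e700 : 700 / (N : ℝ) + 700 / (N : ℝ) ^ 2 * ((n : ℝ) - 2 * N / 3) ^ 2 =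
        700 * (1 / (N : ℝ)) + 700 * (1 / (N : ℝ) ^ 2 * ((n : ℝ) - 2 * N / 3) ^ 2) := by ring
    rw [e700]
    rcases sixth_le_or_sq_le hN n with h | h
    · have hn1 : (0 : ℝ) < n := by linarith
      have h1 := abs_walkCdf_sub_le (n := n) (by exact_mod_cast hn1) w
      have h2 := abs_inv_sqrt_sub_le hN h
      have h3 : 106 / (n : ℝ) ≤ 636 * (1 / N) := by
        rw [mul_one_div, div_le_div_iff₀ hn1 (by linarith)]; linarith
      have e : walkCdf n (w * √n) - Φ w - φ w * (√6 / √N) * sawtooth u =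
          (walkCdf n (w * √n) - (Φ w + φ w * (2 / √n * sawtooth u))) +
            φ w * sawtooth u * (2 / √n - √6 / √N) := by ring
      have h4 : |φ w * sawtooth u * (2 / √n - √6 / √N)| ≤
          4 / N + 4 / (N : ℝ) ^ 2 * ((n : ℝ) - 2 * N / 3) ^ 2 := by
        rw [abs_mul, abs_mul, abs_of_nonneg hφ0]
        refine le_trans (mul_le_of_le_one_left (abs_nonneg _) ?_) h2
        nlinarith [abs_nonneg (sawtooth u)]
      have e4 : 4 / (N : ℝ) + 4 / (N : ℝ) ^ 2 * ((n : ℝ) - 2 * N / 3) ^ 2 =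
          4 * (1 / (N : ℝ)) + 4 * (1 / (N : ℝ) ^ 2 * ((n : ℝ) - 2 * N / 3) ^ 2) := by ring
      rw [e]
      refine (abs_add_le _ _).trans ?_
      linarith
    · have h1 : |walkCdf n (w * √n) - Φ w| ≤ 1 := by
        have := walkCdf_mem_Icc n (w * √n)
        rw [abs_le]
        constructor <;> linarith [this.1, this.2, cdf_nonneg (gaussianReal 0 1) w,
          cdf_le_one (gaussianReal 0 1) w]
      have h2 : |φ w * (√6 / √N) * sawtooth u| ≤ 2 := by
        rw [abs_mul, abs_of_nonneg (by positivity)]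
        have : φ w * (√6 / √N) ≤ 1 * 2.5 := by gcongr
        have h3 : φ w * (√6 / √N) * |sawtooth u| ≤ (1 * 2.5) * (1 / 2) := by gcongr
        linarith
      have e4 : 4 / (N : ℝ) ^ 2 * ((n : ℝ) - 2 * N / 3) ^ 2 =
          4 * (1 / (N : ℝ) ^ 2 * ((n : ℝ) - 2 * N / 3) ^ 2) := by ring
      refine (abs_sub _ _).trans ?_
      linarith
  · have : 700 / (N : ℝ) + 700 / (N : ℝ) ^ 2 * (2 * N / 9) = (700 + 1400 / 9) / N := by
      field_simp; norm_num
    rw [this]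
    gcongr
    norm_num

/-- The Berry-Esseen bound for the self-normalized sum. -/
lemma normalApproxError_le {N : ℕ} (hN : 0 < N) : normalApproxError N ≤ 902 / √N := by
  have hN1 : (1 : ℝ) ≤ N := by exact_mod_cast hN
  refine ciSup_le fun ⟨w, hw⟩ => ?_
  simp only
  rw [distFun_eq N (le_of_lt hw)]
  have h1 := abs_mixCdf_sub_sub_le hN w
  set S := binMean N (fun n => sawtooth ((w * √n - n) / 2))
  have hS : |S| ≤ 1 / 2 := by
    refine (abs_binMean_le N _).trans ?_
    rw [← binMean_const N (1 / 2)]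
    exact binMean_mono fun n _ => abs_sawtooth_le _
  have h2 : |φ w * (√6 / √N) * S| ≤ 2 / √N := by
    have s1 := sqrt_six_le
    have hφ0 := stdPDF_nonneg w
    rw [abs_mul, abs_of_nonneg (by positivity)]
    calc φ w * (√6 / √N) * |S| ≤ 1 * (2.5 / √N) * (1 / 2) := by
          gcongr; exact stdPDF_le_one w
      _ ≤ _ := by rw [one_mul, div_mul_eq_mul_div]; gcongr; norm_num
  have h3 : 900 / (N : ℝ) ≤ 900 / √N := by
    gcongr
    rw [Real.sqrt_le_left (by positivity)]; nlinarith
  have h4 : 902 / √(N : ℝ) = 900 / √N + 2 / √N := by ring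
  rw [h4]
  calc |mixCdf N w - Φ w| = |(mixCdf N w - Φ w - φ w * (√6 / √N) * S) + φ w * (√6 / √N) * S| := by
        ring_nf
    _ ≤ _ := (abs_add_le _ _).trans (by linarith)

/-! ### The sawtooth and its periodic primitive -/

/-- The periodic Bernoulli function `{u}² - {u} + 1/6`. -/
noncomputable def periodicBernoulliTwo (u : ℝ) : ℝ := Int.fract u ^ 2 - Int.fract u + 1 / 6

lemma measurable_periodicBernoulliTwo : Measurable periodicBernoulliTwo := by
  unfold periodicBernoulliTwo
  exact ((measurable_fract.pow_const 2).sub measurable_fract).add_const _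

lemma abs_periodicBernoulliTwo_le (u : ℝ) : |periodicBernoulliTwo u| ≤ 1 := by
  have h1 := Int.fract_nonneg u
  have h2 := Int.fract_lt_one u
  rw [periodicBernoulliTwo, abs_le]
  constructor <;> nlinarith

/-- This series converges absolutely, unlike that of the sawtooth; smoothing is therefore carried
out here first and differentiated afterwards. -/
lemma hasSum_periodicBernoulliTwo (u : ℝ) :
    HasSum (fun n : ℕ => 1 / (Real.pi ^ 2 * (n : ℝ) ^ 2) * Real.cos (2 * Real.pi * n * u))
      (periodicBernoulliTwo u) := by
  have h := (hasSum_one_div_nat_pow_mul_cos one_ne_zero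
    (x := Int.fract u) ⟨Int.fract_nonneg u, (Int.fract_lt_one u).le⟩).mul_left (1 / Real.pi ^ 2)
  convert! h using 1
  · ext n
    rw [← mul_assoc, one_div_mul_one_div, mul_one]
    congr 1
    have : 2 * Real.pi * n * u = 2 * Real.pi * n * Int.fract u +
        ((n * ⌊u⌋ : ℤ) : ℝ) * (2 * Real.pi) := by
      rw [Int.fract]; push_cast; ring
    rw [this, Real.cos_add_int_mul_two_pi]
  · have hB : (Polynomial.map (algebraMap ℚ ℝ) (Polynomial.bernoulli 2)).eval (Int.fract u) =
        periodicBernoulliTwo u := by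
      simp [Polynomial.bernoulli, Finset.sum_range_succ, periodicBernoulliTwo, bernoulli_one,
        bernoulli_two, Polynomial.eval_monomial]
      ring
    rw [mul_one, hB]
    have := Real.pi_ne_zero
    simp
    field_simp

/-- The Lipschitz bound holds across the kinks at the integers, which permits differentiation under
the integral sign. -/
lemma abs_periodicBernoulliTwo_sub_le (u v : ℝ) :
    |periodicBernoulliTwo u - periodicBernoulliTwo v| ≤ |u - v| := by
  wlog huv : u ≤ v generalizing u v
  · rw [abs_sub_comm, abs_sub_comm u]; exact this v u (le_of_not_ge huv)
  have hx0 := Int.fract_nonneg u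
  have hx1 := Int.fract_lt_one u
  have hy0 := Int.fract_nonneg v
  have hy1 := Int.fract_lt_one v
  have hfl := Int.floor_mono huv
  have hu := Int.floor_add_fract u
  have hv := Int.floor_add_fract v
  rw [abs_sub_comm u, abs_of_nonneg (sub_nonneg.2 huv), periodicBernoulliTwo,
    periodicBernoulliTwo]
  rcases hfl.eq_or_lt with h | h
  · rw [h] at hu
    rw [abs_le]
    constructor <;> nlinarith
  · have h' : (⌊u⌋ : ℝ) + 1 ≤ ⌊v⌋ := by exact_mod_cast h
    rw [abs_le]
    constructor <;> nlinarith

lemma hasDerivAt_periodicBernoulliTwo {u : ℝ} (hu : ∀ m : ℤ, u ≠ m) :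
    HasDerivAt periodicBernoulliTwo (-2 * sawtooth u) u := by
  have h1 : (⌊u⌋ : ℝ) < u := lt_of_le_of_ne (Int.floor_le u) (hu ⌊u⌋).symm
  have h2 : HasDerivAt (fun v : ℝ => (v - ⌊u⌋) ^ 2 - (v - ⌊u⌋) + 1 / 6) (-2 * sawtooth u) u := by
    have h3 := (hasDerivAt_id u).sub_const (⌊u⌋ : ℝ)
    convert! ((h3.pow 2).sub h3).add_const (1 / 6) using 1
    rw [sawtooth, Int.fract]
    simp only [id, Nat.cast_ofNat]
    ring
  refine h2.congr_of_eventuallyEq ?_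
  filter_upwards [Ioo_mem_nhds h1 (Int.lt_floor_add_one u)] with v hv
  have : ⌊v⌋ = ⌊u⌋ := Int.floor_eq_iff.2 ⟨hv.1.le, hv.2⟩
  rw [periodicBernoulliTwo, Int.fract, this]

/-! ### Smoothing laws -/

namespace IsSmoothingLaw

variable {μ : Measure ℝ}

lemma absolutelyContinuous (hμ : IsSmoothingLaw μ) : μ ≪ volume := by
  obtain ⟨p, -, -, rfl, -⟩ := hμ.density_decay
  exact withDensity_absolutelyContinuous _ _

/-- With x = |y|^(2/3) one has y² = x³, and x^k e^(-ax) ≤ k!/a^k for k = 3, 6 dominates the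
integrand by a multiple of 1/(1 + y²). -/
lemma integrable_sq (hμ : IsSmoothingLaw μ) : Integrable (fun y : ℝ => y ^ 2) μ := by
  obtain ⟨p, hp, hp0, rfl, A, a, ha, hA⟩ := hμ.density_decay
  rw [integrable_withDensity_iff_integrable_smul' hp.ennreal_ofReal (by simp)]
  simp_rw [ENNReal.toReal_ofReal (hp0 _), smul_eq_mul]
  have hA0 : 0 ≤ A := by
    have := (hp0 0).trans (hA 0)
    exact nonneg_of_mul_nonneg_left this (Real.exp_pos _)
  have hbd : ∀ y : ℝ, y ^ 2 * (1 + y ^ 2) * Real.exp (-a * |y| ^ (2 / 3 : ℝ)) ≤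
      6 / a ^ 3 + 720 / a ^ 6 := by
    intro y
    set x := |y| ^ (2 / 3 : ℝ) with hx
    have hx0 : 0 ≤ x := by positivity
    have hxy : y ^ 2 = x ^ 3 := by
      rw [hx, ← Real.rpow_natCast (|y| ^ _), ← Real.rpow_mul (abs_nonneg y), ← sq_abs]; norm_num
    have h1 : ∀ k : ℕ, x ^ k * Real.exp (-a * x) ≤ k.factorial / a ^ k := by
      intro k
      have h2 := Real.pow_div_factorial_le_exp (a * x) (mul_nonneg ha.le hx0) k
      rw [div_le_iff₀ (by positivity), mul_pow] at h2
      rw [neg_mul, Real.exp_neg, ← div_eq_mul_inv, div_le_div_iff₀ (Real.exp_pos _) (by positivity)]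
      linarith
    have h3 := h1 3
    have h6 := h1 6
    norm_num [Nat.factorial] at h3 h6
    rw [hxy, neg_mul]
    calc _ = x ^ 3 * Real.exp (-(a * x)) + x ^ 6 * Real.exp (-(a * x)) := by ring
      _ ≤ _ := by linarith
  refine (integrable_inv_one_add_sq.const_mul (A * (6 / a ^ 3 + 720 / a ^ 6))).mono'
    (hp.mul (by fun_prop)).aestronglyMeasurable (.of_forall fun y => ?_)
  rw [Real.norm_eq_abs, abs_of_nonneg (mul_nonneg (hp0 y) (sq_nonneg y)), ← div_eq_mul_inv,
    le_div_iff₀ (by positivity)]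
  calc p y * y ^ 2 * (1 + y ^ 2) ≤
        A * Real.exp (-a * |y| ^ (2 / 3 : ℝ)) * y ^ 2 * (1 + y ^ 2) := by gcongr; exact hA y
    _ = A * (y ^ 2 * (1 + y ^ 2) * Real.exp (-a * |y| ^ (2 / 3 : ℝ))) := by ring
    _ ≤ _ := by gcongr; exact hbd y

lemma integrable_abs (hμ : IsSmoothingLaw μ) : Integrable (fun y : ℝ => |y|) μ := by
  have := hμ.isProbabilityMeasure
  refine ((integrable_const 1).add hμ.integrable_sq).mono' (by fun_prop)
    (.of_forall fun y => ?_)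
  rw [Real.norm_eq_abs, abs_abs, Pi.add_apply, ← sq_abs]
  nlinarith [sq_nonneg (|y| - 1)]

lemma integral_cos (hμ : IsSmoothingLaw μ) (t : ℝ) :
    ∫ y, Real.cos (t * y) ∂μ = (charFun μ t).re := by
  have := hμ.isProbabilityMeasure
  rw [charFun_apply_real, ← RCLike.re_eq_complex_re, ← integral_re]
  · congr with y
    rw [← Complex.ofReal_mul, RCLike.re_eq_complex_re, Complex.exp_ofReal_mul_I_re]
  · refine (integrable_const (1 : ℝ)).mono' (by fun_prop) (.of_forall fun y => ?_)
    rw [← Complex.ofReal_mul, Complex.norm_exp_ofReal_mul_I]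

lemma integral_sin (hμ : IsSmoothingLaw μ) (t : ℝ) : ∫ y, Real.sin (t * y) ∂μ = 0 := by
  have := hμ.isProbabilityMeasure
  rw [← hμ.charFun_im t, charFun_apply_real, ← RCLike.im_eq_complex_im, ← integral_im]
  · congr with y
    rw [← Complex.ofReal_mul, RCLike.im_eq_complex_im, Complex.exp_ofReal_mul_I_im]
  · refine (integrable_const (1 : ℝ)).mono' (by fun_prop) (.of_forall fun y => ?_)
    rw [← Complex.ofReal_mul, Complex.norm_exp_ofReal_mul_I]

lemma integral_cos_sub (hμ : IsSmoothingLaw μ) (s t : ℝ) :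
    ∫ y, Real.cos (s - t * y) ∂μ = Real.cos s * (charFun μ t).re := by
  have := hμ.isProbabilityMeasure
  simp_rw [Real.cos_sub]
  have hb : ∀ f : ℝ → ℝ, Continuous f → (∀ y, |f y| ≤ 1) → Integrable f μ := fun f hf h =>
    (integrable_const (1 : ℝ)).mono' hf.aestronglyMeasurable (.of_forall h)
  rw [integral_add, integral_const_mul, integral_const_mul, hμ.integral_cos, hμ.integral_sin]
  · ring
  · exact (hb _ (by fun_prop) fun y => Real.abs_cos_le_one _).const_mul _
  · exact (hb _ (by fun_prop) fun y => Real.abs_sin_le_one _).const_mul _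

lemma abs_charFun_re_le (hμ : IsSmoothingLaw μ) (t : ℝ) : |(charFun μ t).re| ≤ 1 := by
  have := hμ.isProbabilityMeasure
  exact (Complex.abs_re_le_norm _).trans (norm_charFun_le_one t)

lemma abs_charFun_re_sub_le (hμ : IsSmoothingLaw μ) (s t : ℝ) :
    |(charFun μ s).re - (charFun μ t).re| ≤ |s - t| * ∫ y, |y| ∂μ := by
  have := hμ.isProbabilityMeasure
  have hb : ∀ t : ℝ, Integrable (fun y => Real.cos (t * y)) μ := fun t =>
    (integrable_const (1 : ℝ)).mono' (by fun_prop) (.of_forall fun y => Real.abs_cos_le_one _)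
  rw [← hμ.integral_cos, ← hμ.integral_cos, ← integral_sub (hb s) (hb t), ← integral_const_mul,
    ← Real.norm_eq_abs]
  refine norm_integral_le_of_norm_le (hμ.integrable_abs.const_mul _) (.of_forall fun y => ?_)
  rw [Real.norm_eq_abs, ← abs_mul, sub_mul]
  exact Real.abs_cos_sub_cos_le _ _

lemma integrable_of_bounded (hμ : IsSmoothingLaw μ) {f : ℝ → ℝ} (hf : Measurable f) (C : ℝ)
    (h : ∀ y, |f y| ≤ C) : Integrable f μ := by
  have := hμ.isProbabilityMeasure
  exact (integrable_const C).mono' hf.aestronglyMeasurable (.of_forall h)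

/-- Integrating term by term multiplies the n-th mode by the characteristic function at 2πnδ; by
`hK` every n > K falls outside its support, so the series becomes a finite sum. -/
lemma integral_periodicBernoulliTwo (hμ : IsSmoothingLaw μ) {δ : ℝ} (hδ : 0 < δ) {K : ℕ}
    (hK : 1 < 2 * Real.pi * (K + 1) * δ) (u : ℝ) :
    ∫ y, periodicBernoulliTwo (u - δ * y) ∂μ =
      ∑ k ∈ Finset.Icc 1 K, 1 / (Real.pi ^ 2 * (k : ℝ) ^ 2) *
        (Real.cos (2 * Real.pi * k * u) * (charFun μ (2 * Real.pi * k * δ)).re) := by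
  have := hμ.isProbabilityMeasure
  have hsum : Summable fun n : ℕ => 1 / (Real.pi ^ 2 * (n : ℝ) ^ 2) := by
    simp_rw [← one_div_mul_one_div]
    exact (Real.summable_one_div_nat_pow.2 one_lt_two).mul_left _
  have h := hasSum_integral_of_dominated_convergence (μ := μ)
    (F := fun (n : ℕ) y => 1 / (Real.pi ^ 2 * (n : ℝ) ^ 2) *
      Real.cos (2 * Real.pi * n * (u - δ * y)))
    (f := fun y => periodicBernoulliTwo (u - δ * y))
    (fun n _ => 1 / (Real.pi ^ 2 * (n : ℝ) ^ 2)) (fun n => by fun_prop)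
    (fun n => .of_forall fun y => by
      rw [norm_mul, Real.norm_of_nonneg (by positivity)]
      exact mul_le_of_le_one_right (by positivity) (Real.abs_cos_le_one _))
    (.of_forall fun _ => hsum) (integrable_const _)
    (.of_forall fun y => hasSum_periodicBernoulliTwo _)
  have e : ∀ n : ℕ, ∫ y, 1 / (Real.pi ^ 2 * (n : ℝ) ^ 2) *
      Real.cos (2 * Real.pi * n * (u - δ * y)) ∂μ = 1 / (Real.pi ^ 2 * (n : ℝ) ^ 2) *
        (Real.cos (2 * Real.pi * n * u) * (charFun μ (2 * Real.pi * n * δ)).re) := fun n => by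
    rw [integral_const_mul, ← hμ.integral_cos_sub]
    congr with y
    ring_nf
  simp_rw [e] at h
  refine h.unique (hasSum_sum_of_ne_finset_zero fun n hn => ?_)
  rw [Finset.mem_Icc, not_and_or, not_le, not_le, Nat.lt_one_iff] at hn
  rcases hn with rfl | hn
  · simp
  · have h1 : (K : ℝ) + 1 ≤ n := by exact_mod_cast hn
    have h2 : 1 < |2 * Real.pi * n * δ| := by
      rw [abs_of_nonneg (by positivity)]
      refine hK.trans_le ?_
      gcongr
    rw [hμ.charFun_support _ h2]
    simp

/-- The exceptional y form a countable set, null because the law has a density. -/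
lemma ae_ne_int (hμ : IsSmoothingLaw μ) {δ : ℝ} (hδ : 0 < δ) (u : ℝ) :
    ∀ᵐ y ∂μ, ∀ m : ℤ, u - δ * y ≠ m := by
  refine hμ.absolutelyContinuous ?_
  have : {y : ℝ | ∀ m : ℤ, u - δ * y ≠ m}ᶜ ⊆ Set.range fun m : ℤ => (u - m) / δ := by
    intro y hy
    simp only [Set.mem_compl_iff, Set.mem_ofPred_eq, not_forall, not_not] at hy
    obtain ⟨m, hm⟩ := hy
    exact ⟨m, by simp only; rw [← hm]; field_simp; ring⟩
  exact ((Set.countable_range _).mono this).measure_zero _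

/-- The smoothed sawtooth is a trigonometric polynomial. -/
lemma integral_sawtooth (hμ : IsSmoothingLaw μ) {δ : ℝ} (hδ : 0 < δ) {K : ℕ}
    (hK : 1 < 2 * Real.pi * (K + 1) * δ) (u : ℝ) :
    ∫ y, sawtooth (u - δ * y) ∂μ =
      ∑ k ∈ Finset.Icc 1 K, 1 / (Real.pi * k) * (charFun μ (2 * Real.pi * k * δ)).re *
        Real.sin (2 * Real.pi * k * u) := by
  have := hμ.isProbabilityMeasure
  have hmeas : ∀ v : ℝ, Measurable fun y => periodicBernoulliTwo (v - δ * y) := fun v =>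
    measurable_periodicBernoulliTwo.comp (by fun_prop)
  have hsaw : Measurable fun y => sawtooth (u - δ * y) := measurable_sawtooth.comp (by fun_prop)
  -- The sawtooth is -1/2 times the almost everywhere derivative of the Bernoulli function. The
  -- identity for the latter is differentiated in u on both sides, and uniqueness of the derivative
  -- transfers it.
  have h1 : HasDerivAt (fun v => ∫ y, periodicBernoulliTwo (v - δ * y) ∂μ)
      (∫ y, -2 * sawtooth (u - δ * y) ∂μ) u := by
    refine (hasDerivAt_integral_of_dominated_loc_of_lip (bound := fun _ => 1)
      (s := Set.univ) Filter.univ_mem (.of_forall fun v => (hmeas v).aestronglyMeasurable)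
      (hμ.integrable_of_bounded (hmeas u) 1 fun y => abs_periodicBernoulliTwo_le _)
      (hsaw.const_mul (-2)).aestronglyMeasurable (.of_forall fun y => ?_) (integrable_const 1)
      ?_).2
    · refine LipschitzWith.lipschitzOnWith (LipschitzWith.of_dist_le_mul fun v w => ?_)
      rw [Real.dist_eq, Real.dist_eq, Real.coe_nnabs, abs_one, one_mul]
      refine (abs_periodicBernoulliTwo_sub_le _ _).trans_eq ?_
      ring_nf
    · filter_upwards [hμ.ae_ne_int hδ u] with y hy
      exact (hasDerivAt_periodicBernoulliTwo hy).comp_sub_const u (δ * y)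
  simp_rw [hμ.integral_periodicBernoulliTwo hδ hK] at h1
  have h2 : HasDerivAt (fun v : ℝ => ∑ k ∈ Finset.Icc 1 K, 1 / (Real.pi ^ 2 * (k : ℝ) ^ 2) *
        (Real.cos (2 * Real.pi * k * v) * (charFun μ (2 * Real.pi * k * δ)).re))
      (∑ k ∈ Finset.Icc 1 K, -2 * (1 / (Real.pi * k) * (charFun μ (2 * Real.pi * k * δ)).re *
        Real.sin (2 * Real.pi * k * u))) u := by
    refine HasDerivAt.fun_sum fun k hk => ?_
    have hk0 : (k : ℝ) ≠ 0 := by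
      have := (Finset.mem_Icc.1 hk).1
      positivity
    have h3 : HasDerivAt (fun v : ℝ => Real.cos (2 * Real.pi * k * v))
        (-Real.sin (2 * Real.pi * k * u) * (2 * Real.pi * k)) u := by
      simpa using ((hasDerivAt_id u).const_mul (2 * Real.pi * k)).cos
    convert! (h3.mul_const (charFun μ (2 * Real.pi * k * δ)).re).const_mul
      (1 / (Real.pi ^ 2 * (k : ℝ) ^ 2)) using 1
    have := Real.pi_ne_zero
    field_simp
  have h3 := h1.unique h2
  rw [integral_const_mul, ← Finset.mul_sum] at h3
  linarith

end IsSmoothingLaw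

/-! ### Binomial averages of oscillating terms -/

lemma norm_pow_sub_pow_le_of_norm_le_one {a b : ℂ} (ha : ‖a‖ ≤ 1) (hb : ‖b‖ ≤ 1) (n : ℕ) :
    ‖a ^ n - b ^ n‖ ≤ n * ‖a - b‖ := by
  induction n with
  | zero => simp
  | succ n ih =>
    have e : a ^ (n + 1) - b ^ (n + 1) = a * (a ^ n - b ^ n) + (a - b) * b ^ n := by ring
    rw [e]
    refine (norm_add_le _ _).trans ?_
    rw [norm_mul, norm_mul, norm_pow]
    have h1 : ‖b‖ ^ n ≤ 1 := pow_le_one₀ (norm_nonneg _) hb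
    push_cast
    nlinarith [norm_nonneg (a - b), norm_nonneg (a ^ n - b ^ n)]

lemma binMean_sin (N : ℕ) (α θ : ℝ) :
    binMean N (fun n => Real.sin (α + θ * n)) =
      (Complex.exp (α * Complex.I) * ((1 + 2 * Complex.exp (θ * Complex.I)) / 3) ^ N).im := by
  induction N generalizing α with
  | zero => simp [binMean_zero, Complex.exp_ofReal_mul_I_im]
  | succ N ih =>
    have h1 : (fun n : ℕ => Real.sin (α + θ * ((n + 1 : ℕ) : ℝ))) =
        fun n : ℕ => Real.sin ((α + θ) + θ * n) := by
      ext n; push_cast; ring_nf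
    rw [binMean_succ, h1, ih, ih]
    have h2 : Complex.exp (α * Complex.I) *
        ((1 + 2 * Complex.exp (θ * Complex.I)) / 3) ^ (N + 1) =
        ((1 / 3 : ℝ) : ℂ) * (((2 : ℝ) : ℂ) * (Complex.exp (((α + θ : ℝ) : ℂ) * Complex.I) *
          ((1 + 2 * Complex.exp (θ * Complex.I)) / 3) ^ N) + Complex.exp (α * Complex.I) *
          ((1 + 2 * Complex.exp (θ * Complex.I)) / 3) ^ N) := by
      rw [Complex.ofReal_add, add_mul, Complex.exp_add, pow_succ]
      push_cast
      ring
    rw [h2, Complex.im_ofReal_mul, Complex.add_im, Complex.im_ofReal_mul]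
    ring

/-- The characteristic function of a centered Bernoulli variable with success probability `2/3`,
compared with that of the normal law of the same variance. -/
lemma norm_centered_bernoulli_sub_le (θ : ℝ) :
    ‖Complex.exp ((-(2 * θ / 3) : ℝ) * Complex.I) * ((1 + 2 * Complex.exp (θ * Complex.I)) / 3) -
      (Real.exp (-(θ ^ 2 / 9)) : ℝ)‖ ≤ 4 / 27 * |θ| ^ 3 := by
  -- In this unit the centered variable contributes the phases -2x and x, with probabilities 1/3 and
  -- 2/3.
  set x := θ / 3 with hx
  have hθ : θ = 3 * x := by rw [hx]; ring
  have e : Complex.exp ((-(2 * θ / 3) : ℝ) * Complex.I) *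
      ((1 + 2 * Complex.exp (θ * Complex.I)) / 3) =
      ((1 / 3 : ℝ) : ℂ) * Complex.exp ((-(2 * x) : ℝ) * Complex.I) +
        ((2 / 3 : ℝ) : ℂ) * Complex.exp (x * Complex.I) := by
    have : Complex.exp (x * Complex.I) =
        Complex.exp ((-(2 * x) : ℝ) * Complex.I) * Complex.exp (θ * Complex.I) := by
      rw [← Complex.exp_add, hθ]; congr 1; push_cast; ring
    rw [this, hθ, show 2 * (3 * x) / 3 = 2 * x by ring]
    push_cast; ring
  rw [e, show θ ^ 2 / 9 = x ^ 2 by rw [hθ]; ring,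
    show 4 / 27 * |θ| ^ 3 = 4 * |x| ^ 3 by
      rw [hθ, abs_mul, mul_pow, abs_of_pos (by norm_num : (0 : ℝ) < 3)]; ring]
  refine (Complex.norm_le_abs_re_add_abs_im _).trans ?_
  rw [Complex.sub_re, Complex.sub_im, Complex.add_re, Complex.add_im, Complex.re_ofReal_mul,
    Complex.re_ofReal_mul, Complex.im_ofReal_mul, Complex.im_ofReal_mul,
    Complex.exp_ofReal_mul_I_re, Complex.exp_ofReal_mul_I_im, Complex.exp_ofReal_mul_I_re,
    Complex.exp_ofReal_mul_I_im, Complex.ofReal_re, Complex.ofReal_im, Real.cos_neg, Real.sin_neg,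
    Real.cos_two_mul, Real.sin_two_mul]
  have hc1 := Real.one_sub_sq_div_two_le_cos (x := x)
  have hc2 := Real.cos_le_one x
  have hs : |Real.sin x| ≤ |x| := Real.abs_sin_le_abs
  have him : |1 / 3 * -(2 * Real.sin x * Real.cos x) + 2 / 3 * Real.sin x - 0| ≤
      1 / 3 * |x| ^ 3 := by
    rw [show 1 / 3 * -(2 * Real.sin x * Real.cos x) + 2 / 3 * Real.sin x - 0 =
      2 / 3 * (Real.sin x * (1 - Real.cos x)) by ring, abs_mul, abs_mul,
      abs_of_nonneg (by norm_num : (0 : ℝ) ≤ 2 / 3), abs_of_nonneg (by linarith : 0 ≤ 1 - Real.cos x)]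
    have h1 : 1 - Real.cos x ≤ |x| ^ 2 / 2 := by rw [sq_abs]; linarith
    calc 2 / 3 * (|Real.sin x| * (1 - Real.cos x)) ≤ 2 / 3 * (|x| * (|x| ^ 2 / 2)) := by
          gcongr
      _ = _ := by ring
  have hre : |1 / 3 * (2 * Real.cos x ^ 2 - 1) + 2 / 3 * Real.cos x - Real.exp (-x ^ 2)| ≤
      3 * |x| ^ 3 := by
    rcases le_total |x| 1 with h | h
    · have h1 := (abs_le.1 (Real.cos_bound h)).2
      have h2 : 1 - x ^ 2 ≤ Real.exp (-x ^ 2) := by linarith [Real.add_one_le_exp (-x ^ 2)]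
      have h3 : Real.exp (-x ^ 2) ≤ 1 - x ^ 2 + x ^ 4 := by
        have := (abs_le.1 (Real.abs_exp_sub_one_sub_id_le (x := -x ^ 2)
          (by rw [abs_neg, abs_pow]; exact pow_le_one₀ (abs_nonneg _) h))).2
        nlinarith
      have h4 : x ^ 4 ≤ |x| ^ 3 := by
        rw [show x ^ 4 = |x| ^ 4 by rw [← abs_pow, abs_of_nonneg (by positivity)]]
        exact pow_le_pow_of_le_one (abs_nonneg _) h (by norm_num)
      rw [show |x| ^ 4 = x ^ 4 by rw [← abs_pow, abs_of_nonneg (by positivity)]] at h1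
      have h5 : (1 - Real.cos x) ^ 2 ≤ (x ^ 2 / 2) ^ 2 :=
        pow_le_pow_left₀ (by linarith) (by linarith) 2
      have h6 : 0 ≤ x ^ 4 := by positivity
      rw [abs_le]
      constructor <;> nlinarith [sq_nonneg (1 - Real.cos x)]
    · have h1 : 1 ≤ |x| ^ 3 := one_le_pow₀ h
      have h2 : Real.exp (-x ^ 2) ≤ 1 := Real.exp_le_one_iff.2 (by nlinarith [sq_nonneg x])
      have h3 := Real.exp_pos (-x ^ 2)
      have h4 := Real.neg_one_le_cos x
      rw [abs_le]
      constructor <;> nlinarith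
  have : 0 ≤ |x| ^ 3 := by positivity
  rw [show -(x ^ 2) = -x ^ 2 by ring]
  linarith

lemma norm_bernoulli_charFun_le_one (θ : ℝ) :
    ‖(1 + 2 * Complex.exp (θ * Complex.I)) / 3‖ ≤ 1 := by
  rw [norm_div, div_le_one (by simp)]
  refine (norm_add_le _ _).trans ?_
  rw [norm_mul, Complex.norm_exp_ofReal_mul_I]
  norm_num

/-- `sin` of a linear phase, averaged over the binomial law: comparison with the normal law. -/
lemma abs_binMean_sin_sub_le (N : ℕ) (α θ : ℝ) :
    |binMean N (fun n => Real.sin (α - θ * (2 * N / 3) + θ * n)) -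
      Real.sin α * Real.exp (-(N * θ ^ 2 / 9))| ≤ N * (4 / 27 * |θ| ^ 3) := by
  set g := Complex.exp ((-(2 * θ / 3) : ℝ) * Complex.I) *
    ((1 + 2 * Complex.exp (θ * Complex.I)) / 3) with hg
  have h1 : Complex.exp (((α - θ * (2 * N / 3) : ℝ) : ℂ) * Complex.I) *
      ((1 + 2 * Complex.exp (θ * Complex.I)) / 3) ^ N = Complex.exp (α * Complex.I) * g ^ N := by
    rw [hg, mul_pow, ← Complex.exp_nat_mul, ← mul_assoc, ← Complex.exp_add]
    congr 2
    push_cast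
    ring
  have h2 : Real.sin α * Real.exp (-(N * θ ^ 2 / 9)) =
      (Complex.exp (α * Complex.I) * ((Real.exp (-(θ ^ 2 / 9)) : ℝ) : ℂ) ^ N).im := by
    rw [← Complex.ofReal_pow, ← Real.exp_nat_mul, Complex.im_mul_ofReal,
      Complex.exp_ofReal_mul_I_im]
    congr 2
    ring
  rw [binMean_sin, h1, h2, ← Complex.sub_im, ← mul_sub]
  refine (Complex.abs_im_le_norm _).trans ?_
  rw [norm_mul, Complex.norm_exp_ofReal_mul_I, one_mul]
  refine (norm_pow_sub_pow_le_of_norm_le_one ?_ ?_ N).trans ?_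
  · rw [hg, norm_mul, Complex.norm_exp_ofReal_mul_I, one_mul]
    exact norm_bernoulli_charFun_le_one θ
  · rw [Complex.norm_real, Real.norm_eq_abs, Real.abs_exp, Real.exp_le_one_iff]
    linarith [sq_nonneg θ]
  · exact mul_le_mul_of_nonneg_left (norm_centered_bernoulli_sub_le θ) N.cast_nonneg

/-- For odd k the phase πkn contributes (-1)^n, turning the one-trial factor into (1 - 2e^(iθ))/3,
of modulus at most (1 + |θ|)/3. For |θ| ≤ 1/2 its N-th power is at most 2^(-N); for larger |θ| the
term 2|θ| exceeds the trivial bound 1. -/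
lemma abs_binMean_sin_sub_pi_le {N : ℕ} (hN : 0 < N) (α θ : ℝ) {k : ℕ} (hk : ¬Even k) :
    |binMean N (fun n => Real.sin (α + (θ - Real.pi * k) * n))| ≤ 1 / √N + 2 * |θ| := by
  rw [binMean_sin]
  refine (Complex.abs_im_le_norm _).trans ?_
  rw [norm_mul, Complex.norm_exp_ofReal_mul_I, one_mul, norm_pow]
  have hN1 : (1 : ℝ) ≤ N := by exact_mod_cast hN
  rcases le_or_gt |θ| (1 / 2) with h | h
  · have h1 : ‖(1 + 2 * Complex.exp (((θ - Real.pi * k : ℝ) : ℂ) * Complex.I)) / 3‖ ≤ 1 / 2 := by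
      have e : Complex.exp (((θ - Real.pi * k : ℝ) : ℂ) * Complex.I) =
          -Complex.exp (Complex.I * θ) := by
        have h2 : (((θ - Real.pi * k : ℝ) : ℂ) * Complex.I) =
            Complex.I * θ - k * (Real.pi * Complex.I) := by push_cast; ring
        rw [h2, Complex.exp_sub, Complex.exp_nat_mul, Complex.exp_pi_mul_I,
          (Nat.not_even_iff_odd.1 hk).neg_one_pow]
        rw [div_neg, div_one]
      rw [e, show (1 + 2 * -Complex.exp (Complex.I * θ)) =
        -(Complex.exp (Complex.I * θ) + (Complex.exp (Complex.I * θ) - 1)) by ring, norm_div,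
        norm_neg]
      have h3 := Real.norm_exp_I_mul_ofReal_sub_one_le (x := θ)
      have h4 : ‖Complex.exp (Complex.I * θ)‖ = 1 := by
        rw [mul_comm]; exact Complex.norm_exp_ofReal_mul_I θ
      have h5 := norm_add_le (Complex.exp (Complex.I * θ)) (Complex.exp (Complex.I * θ) - 1)
      rw [Real.norm_eq_abs] at h3
      have h6 : ‖(3 : ℂ)‖ = 3 := by simp
      rw [h6, div_le_iff₀ (by norm_num)]
      linarith
    have h2 : (1 / 2 : ℝ) ^ N ≤ 1 / √N := by
      rw [div_pow, one_pow]
      gcongr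
      have h3 : (N : ℝ) ≤ 2 ^ N := by exact_mod_cast Nat.lt_two_pow_self.le
      refine le_trans ?_ h3
      rw [Real.sqrt_le_left (by positivity)]; nlinarith
    have := pow_le_pow_left₀ (norm_nonneg _) h1 N
    linarith [abs_nonneg θ]
  · have h1 := pow_le_one₀ (n := N) (norm_nonneg _)
      (norm_bernoulli_charFun_le_one (θ - Real.pi * k))
    have : 0 ≤ 1 / √(N : ℝ) := by positivity
    linarith

/-- The remainder is exactly -(√n - √m)²/(2√m), and |√n - √m| ≤ |n - m|/√m. -/
lemma abs_sqrt_sub_linear_le {m : ℝ} (hm : 0 < m) {n : ℝ} (hn : 0 ≤ n) :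
    |√n - (√m + (n - m) / (2 * √m))| ≤ (n - m) ^ 2 / (2 * (m * √m)) := by
  have hb : 0 < √m := Real.sqrt_pos.2 hm
  have ha : 0 ≤ √n := Real.sqrt_nonneg n
  have hb2 : √m ^ 2 = m := Real.sq_sqrt hm.le
  have ha2 : √n ^ 2 = n := Real.sq_sqrt hn
  generalize √m = b at *
  generalize √n = a at *
  rw [← hb2, ← ha2]
  have e : a - (b + (a ^ 2 - b ^ 2) / (2 * b)) = -((a - b) ^ 2 / (2 * b)) := by field_simp; ring
  rw [e, abs_neg, abs_of_nonneg (by positivity), div_le_div_iff₀ (by positivity) (by positivity)]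
  have h1 : (a - b) ^ 2 * b ^ 2 ≤ (a ^ 2 - b ^ 2) ^ 2 := by
    rw [show (a ^ 2 - b ^ 2) ^ 2 = (a - b) ^ 2 * (a + b) ^ 2 by ring]
    gcongr
    linarith
  calc (a - b) ^ 2 * (2 * (b ^ 2 * b)) = (a - b) ^ 2 * b ^ 2 * (2 * b) := by ring
    _ ≤ _ := by gcongr

/-- The limit of the averaged `k`-th Fourier mode. -/
noncomputable def limitMode (N : ℕ) (w : ℝ) (k : ℕ) : ℝ :=
  if Even k then
    Real.sin (Real.pi * k * w * √(2 * N / 3)) * Real.exp (-(Real.pi ^ 2 / 24) * (k : ℝ) ^ 2 * w ^ 2)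
  else 0

/-- With r = √(2N/3), linearising √n gives the slope θ = πkw/(2r), and the binomial variance 2N/9
turns it into exp(-Nθ²/9) = exp(-π²k²w²/24). The quadratic error of the linearisation is paid for by
the variance. -/
lemma abs_binMean_mode_sub_le {N : ℕ} (hN : 0 < N) (w : ℝ) {k : ℕ} (hk : 1 ≤ k) :
    |binMean N (fun n => Real.sin (Real.pi * k * (w * √n - n))) - limitMode N w k| ≤
      12 * (k : ℝ) ^ 3 * (1 + |w|) ^ 3 / √N := by
  have hN1 : (1 : ℝ) ≤ N := by exact_mod_cast hN
  have hk1 : (1 : ℝ) ≤ k := by exact_mod_cast hk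
  have hw := abs_nonneg w
  have hπ := Real.pi_pos
  have hπ2 := Real.pi_lt_d2
  set r := √(2 * (N : ℝ) / 3) with hr
  have hr2 : r ^ 2 = 2 * N / 3 := Real.sq_sqrt (by positivity)
  have hr0 : 0 < r := by rw [hr]; positivity
  have hs0 : 0 < √(N : ℝ) := by positivity
  have hs2 : √(N : ℝ) ^ 2 = N := Real.sq_sqrt (by positivity)
  have hrs : 4 / 5 * √(N : ℝ) ≤ r := by
    rw [hr, Real.le_sqrt (by positivity) (by positivity), mul_pow, hs2]; linarith
  set θ := Real.pi * k * w / (2 * r) with hθ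
  have hθabs : |θ| ≤ 2 * k * |w| / √N := by
    rw [hθ, abs_div, abs_mul, abs_of_pos (by positivity : 0 < Real.pi * k),
      abs_of_pos (by positivity : 0 < 2 * r), div_le_div_iff₀ (by positivity) hs0]
    have : Real.pi * √(N : ℝ) ≤ 4 * r := by nlinarith
    calc Real.pi * k * |w| * √N = k * |w| * (Real.pi * √N) := by ring
      _ ≤ k * |w| * (4 * r) := by gcongr
      _ = _ := by ring
  set α := Real.pi * k * w * r with hα
  have hlin : |binMean N (fun n => Real.sin (Real.pi * k * (w * √n - n))) -
      binMean N (fun n => Real.sin (α - θ * (2 * N / 3) + (θ - Real.pi * k) * n))| ≤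
      k * |w| / √N := by
    rw [← binMean_sub]
    refine (abs_binMean_le_of_quadratic (α := 0)
      (β := Real.pi * k * |w| / (N * √N)) fun n _ => ?_).trans ?_
    · refine (Real.abs_sin_sub_sin_le _ _).trans ?_
      have e : Real.pi * k * (w * √n - n) - (α - θ * (2 * N / 3) + (θ - Real.pi * k) * n) =
          Real.pi * k * w * (√n - (r + ((n : ℝ) - 2 * N / 3) / (2 * r))) := by
        rw [hα, hθ]; field_simp; ring
      have h := abs_sqrt_sub_linear_le (m := 2 * N / 3) (by positivity) (n := n) (by positivity)
      rw [← hr] at h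
      rw [e, abs_mul, abs_mul, abs_of_pos (by positivity : 0 < Real.pi * k), zero_add]
      calc _ ≤ Real.pi * k * |w| * (((n : ℝ) - 2 * N / 3) ^ 2 / (2 * (2 * N / 3 * r))) := by
            gcongr
        _ ≤ Real.pi * k * |w| * (((n : ℝ) - 2 * N / 3) ^ 2 / (N * √N)) := by
            refine mul_le_mul_of_nonneg_left (div_le_div_of_nonneg_left (sq_nonneg _)
              (by positivity) ?_) (by positivity)
            nlinarith [mul_le_mul_of_nonneg_left hrs (N.cast_nonneg (α := ℝ)),
              mul_pos (show (0 : ℝ) < N by linarith) hs0]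
        _ = _ := by ring
    · rw [zero_add, div_mul_eq_mul_div, div_le_div_iff₀ (by positivity) hs0]
      have : Real.pi * (2 / 9) ≤ 1 := by linarith
      calc Real.pi * k * |w| * (2 * N / 9) * √N = k * |w| * (N * √N) * (Real.pi * (2 / 9)) := by
            ring
        _ ≤ k * |w| * (N * √N) * 1 := by gcongr
        _ = _ := by ring
  have hpoly : 10 * ((k : ℝ) ^ 3 * |w| ^ 3) + k * |w| ≤ 12 * (k : ℝ) ^ 3 * (1 + |w|) ^ 3 := by
    have h1 : (k : ℝ) ≤ k ^ 3 := le_self_pow₀ hk1 (by norm_num)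
    have h2 : |w| ^ 3 ≤ (1 + |w|) ^ 3 := by gcongr; linarith
    have h3 : |w| ≤ (1 + |w|) ^ 3 :=
      (by linarith : |w| ≤ 1 + |w|).trans (le_self_pow₀ (by linarith) (by norm_num))
    have h4 : k * |w| ≤ (k : ℝ) ^ 3 * (1 + |w|) ^ 3 := by gcongr
    have h5 : (k : ℝ) ^ 3 * |w| ^ 3 ≤ (k : ℝ) ^ 3 * (1 + |w|) ^ 3 := by gcongr
    have h6 : 0 ≤ (k : ℝ) ^ 3 * (1 + |w|) ^ 3 := by positivity
    linarith
  have hpoly2 : 1 + 5 * (k * |w|) ≤ 12 * (k : ℝ) ^ 3 * (1 + |w|) ^ 3 := by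
    have h1 : (k : ℝ) ≤ k ^ 3 := le_self_pow₀ hk1 (by norm_num)
    have h3 : 1 + |w| ≤ (1 + |w|) ^ 3 := le_self_pow₀ (by linarith) (by norm_num)
    have h4 : k * (1 + |w|) ≤ (k : ℝ) ^ 3 * (1 + |w|) ^ 3 := by gcongr
    nlinarith
  by_cases hev : Even k
  · obtain ⟨j, hj⟩ := hev
    have hlim : limitMode N w k = Real.sin α * Real.exp (-(N * θ ^ 2 / 9)) := by
      rw [limitMode, if_pos ⟨j, hj⟩, ← hr]
      congr 2
      rw [hθ, div_pow, mul_pow 2 r, hr2]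
      field_simp
      ring
    -- For even k = 2j the phase πkn is the multiple jn of 2π and drops out.
    have hsin : ∀ n : ℕ, Real.sin (α - θ * (2 * N / 3) + (θ - Real.pi * k) * n) =
        Real.sin (α - θ * (2 * N / 3) + θ * n) := fun n => by
      rw [← Real.sin_sub_nat_mul_two_pi (α - θ * (2 * N / 3) + θ * n) (j * n)]
      congr 1
      rw [hj]; push_cast; ring
    simp_rw [hsin] at hlin
    have h1 := abs_binMean_sin_sub_le N α θ
    have h2 : N * (4 / 27 * |θ| ^ 3) ≤ 10 * ((k : ℝ) ^ 3 * |w| ^ 3) / √N := by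
      calc N * (4 / 27 * |θ| ^ 3) ≤ N * (4 / 27 * (2 * k * |w| / √N) ^ 3) := by gcongr
        _ = √N ^ 2 * (4 / 27 * (2 * k * |w| / √N) ^ 3) := by rw [hs2]
        _ = 32 / 27 * ((k : ℝ) ^ 3 * |w| ^ 3) / √N := by field_simp; ring
        _ ≤ _ := by gcongr; norm_num
    rw [hlim]
    refine (abs_sub_le _ _ _).trans ((add_le_add hlin (h1.trans h2)).trans ?_)
    rw [← add_div]
    gcongr
    linarith
  · rw [limitMode, if_neg hev, sub_zero]
    have h1 := abs_binMean_sin_sub_pi_le hN (α - θ * (2 * N / 3)) θ hev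
    have h2 : 2 * |θ| ≤ 4 * (k * |w|) / √N := by
      calc 2 * |θ| ≤ 2 * (2 * k * |w| / √N) := by gcongr
        _ = _ := by ring
    have h3 := abs_sub_abs_le_abs_sub
      (binMean N (fun n => Real.sin (Real.pi * k * (w * √n - n))))
      (binMean N (fun n => Real.sin (α - θ * (2 * N / 3) + (θ - Real.pi * k) * n)))
    have h4 : |binMean N (fun n => Real.sin (Real.pi * k * (w * √n - n)))| ≤
        k * |w| / √N + (1 / √N + 4 * (k * |w|) / √N) := by linarith
    refine h4.trans ?_
    rw [← add_div, ← add_div]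
    gcongr
    linarith

lemma sum_limitMode (N : ℕ) (w : ℝ) (M : ℕ) (c : ℕ → ℝ) :
    ∑ k ∈ Finset.Icc 1 (2 * M), c k * limitMode N w k =
      ∑ j ∈ Finset.Icc 1 M, c (2 * j) * limitMode N w (2 * j) := by
  induction M with
  | zero => simp
  | succ M ih =>
    rw [show 2 * (M + 1) = 2 * M + 1 + 1 by ring, Finset.sum_Icc_succ_top (by omega),
      Finset.sum_Icc_succ_top (by omega), Finset.sum_Icc_succ_top (by omega), ih]
    have : ¬Even (2 * M + 1) := by simp
    rw [limitMode, if_neg this, mul_zero, add_zero, show 2 * (M + 1) = 2 * M + 1 + 1 by ring]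

/-! ### Comparison of the smoothed error with the oscillating sum -/

lemma measurable_walkCdf (n : ℕ) : Measurable (walkCdf n) := by
  induction n with
  | zero =>
    have : walkCdf 0 = fun x => if 0 ≤ x then (1 : ℝ) else 0 := by ext x; rw [walkCdf]
    rw [this]
    exact Measurable.ite measurableSet_Ici measurable_const measurable_const
  | succ n ih =>
    have : walkCdf (n + 1) = fun x => (walkCdf n (x - 1) + walkCdf n (x + 1)) / 2 := by
      ext x; rw [walkCdf]
    rw [this]
    exact ((ih.comp (by fun_prop)).add (ih.comp (by fun_prop))).div_const 2

lemma measurable_binMean (N : ℕ) {f : ℕ → ℝ → ℝ} (hf : ∀ n, Measurable (f n)) :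
    Measurable fun w => binMean N fun n => f n w :=
  Finset.measurable_sum _ fun n _ => (hf n).const_mul _

lemma measurable_mixCdf_sub (N : ℕ) : Measurable fun w => mixCdf N w - Φ w := by
  refine Measurable.sub (measurable_binMean N fun n => (measurable_walkCdf n).comp (by fun_prop)) ?_
  exact (monotone_cdf _).measurable

lemma abs_binMean_sawtooth_le (N : ℕ) (f : ℕ → ℝ) :
    |binMean N fun n => sawtooth (f n)| ≤ 1 / 2 := by
  refine (abs_binMean_le N _).trans ?_
  rw [← binMean_const N (1 / 2)]
  exact binMean_mono fun n _ => abs_sawtooth_le _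

lemma integral_binMean {μ : Measure ℝ} (N : ℕ) {f : ℕ → ℝ → ℝ} (hf : ∀ n, Integrable (f n) μ) :
    ∫ y, binMean N (fun n => f n y) ∂μ = binMean N fun n => ∫ y, f n y ∂μ := by
  simp only [binMean]
  rw [integral_finsetSum _ fun n _ => (hf n).const_mul _]
  exact Finset.sum_congr rfl fun n _ => integral_const_mul _ _

lemma abs_sqrt_div_sqrt_sub_le {N : ℕ} (hN : 0 < N) (n : ℕ) :
    |√(n : ℝ) / √N - √(2 / 3)| ≤ 1 / √N + 1 / (N * √N) * ((n : ℝ) - 2 * N / 3) ^ 2 := by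
  have hN1 : (0 : ℝ) < N := by exact_mod_cast hN
  have a0 : 0 < √(N : ℝ) := Real.sqrt_pos.2 hN1
  have b0 : 0 ≤ √(n : ℝ) := Real.sqrt_nonneg _
  have a2 : √(N : ℝ) ^ 2 = N := Real.sq_sqrt hN1.le
  have b2 : √(n : ℝ) ^ 2 = n := Real.sq_sqrt n.cast_nonneg
  have s2 : √(2 / 3 : ℝ) ^ 2 = 2 / 3 := Real.sq_sqrt (by norm_num)
  have s1 : 1 / 2 ≤ √(2 / 3 : ℝ) := by rw [Real.le_sqrt (by norm_num) (by norm_num)]; norm_num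
  generalize √(N : ℝ) = a at *
  generalize √(n : ℝ) = b at *
  generalize √(2 / 3 : ℝ) = s at *
  rw [← a2, ← b2]
  have e : b ^ 2 - 2 * a ^ 2 / 3 = (b - s * a) * (b + s * a) := by
    linear_combination a ^ 2 * s2
  have h1 : |b - s * a| * (a / 2) ≤ |b ^ 2 - 2 * a ^ 2 / 3| := by
    rw [e, abs_mul, abs_of_nonneg (by positivity : 0 ≤ b + s * a)]
    gcongr
    nlinarith
  have h2 : b / a - s = (b - s * a) / a := by field_simp
  rw [h2, abs_div, abs_of_pos a0, ← sq_abs (b ^ 2 - 2 * a ^ 2 / 3)]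
  have hz : 0 ≤ |b - s * a| := abs_nonneg _
  generalize |b ^ 2 - 2 * a ^ 2 / 3| = y at *
  generalize |b - s * a| = z at *
  have h3 : z ≤ 2 * y / a := by rw [le_div_iff₀ a0]; linarith
  calc z / a ≤ 2 * y / a / a := by gcongr
    _ ≤ 2 * y / a / a + 1 / a * (1 - y / a) ^ 2 := by
        have : 0 ≤ 1 / a * (1 - y / a) ^ 2 := by positivity
        linarith
    _ = _ := by field_simp; ring

namespace IsSmoothingLaw

variable {μ : Measure ℝ}

/-- The truncated Fourier expansion of the smoothed sawtooth, before averaging. -/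
lemma abs_integral_sawtooth_sub_le (hμ : IsSmoothingLaw μ) {N : ℕ} (hN : 0 < N)
    (hL : 1 ≤ Real.log N) (w : ℝ) (n : ℕ) :
    |∫ y, sawtooth (((w - 1 / (√N * Real.log N) * y) * √n - n) / 2) ∂μ -
      ∑ k ∈ Finset.Icc 1 (2 * ⌊Real.log N⌋₊), 1 / (Real.pi * k) *
        (charFun μ (Real.pi * k * √(2 / 3) / Real.log N)).re *
          Real.sin (Real.pi * k * (w * √n - n))| ≤
      2 * (∫ y, |y| ∂μ) / √N + (2 * (∫ y, |y| ∂μ) / (N * √N) +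
        12 * Real.log N / (N : ℝ) ^ 2) * ((n : ℝ) - 2 * N / 3) ^ 2 := by
  have := hμ.isProbabilityMeasure
  set L := Real.log N with hLdef
  set M := ⌊L⌋₊ with hM
  set m₁ := ∫ y, |y| ∂μ with hm₁
  have hm0 : 0 ≤ m₁ := integral_nonneg fun y => abs_nonneg y
  have hN1 : (1 : ℝ) ≤ N := by exact_mod_cast hN
  have hs0 : 0 < √(N : ℝ) := by positivity
  have hML : (M : ℝ) ≤ L := Nat.floor_le (by linarith)
  have hML' : L < M + 1 := Nat.lt_floor_add_one L
  have hπ := Real.pi_pos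
  have hcard : ∑ k ∈ Finset.Icc 1 (2 * M), (1 : ℝ) = 2 * M := by simp
  have hmod : ∀ k ∈ Finset.Icc 1 (2 * M), (1 : ℝ) ≤ k := fun k hk => by
    exact_mod_cast (Finset.mem_Icc.1 hk).1
  rcases sixth_le_or_sq_le hN n with h | h
  · have hn1 : (0 : ℝ) < n := by linarith
    set δ := √(n : ℝ) / (2 * (√N * L)) with hδ
    have hδ0 : 0 < δ := by positivity
    have e1 : ∀ y, ((w - 1 / (√N * L) * y) * √n - n) / 2 = (w * √n - n) / 2 - δ * y := fun y => by
      rw [hδ]; field_simp; ring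
    -- In the sawtooth variable the smoothing scale is δ, so 2⌊log N⌋ modes suffice: n ≥ N/6 gives
    -- √N ≤ 2.5√n, and 2.5 < π.
    have hK : 1 < 2 * Real.pi * (((2 * M : ℕ) : ℝ) + 1) * δ := by
      have h1 : √(N : ℝ) ≤ 2.5 * √n := by
        rw [Real.sqrt_le_left (by positivity), mul_pow, Real.sq_sqrt hn1.le]
        linarith
      have h2 : L ≤ ((2 * M : ℕ) : ℝ) + 1 := by push_cast; linarith
      rw [hδ, ← mul_div_assoc, one_lt_div (by positivity)]
      have hsn : 0 < √(n : ℝ) := by positivity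
      calc 2 * (√N * L) ≤ 2 * (2.5 * √n * L) := by gcongr
        _ < 2 * (Real.pi * √n * L) := by gcongr; linarith [Real.pi_gt_three]
        _ ≤ 2 * (Real.pi * √n * (((2 * M : ℕ) : ℝ) + 1)) := by gcongr
        _ = _ := by ring
    simp_rw [e1]
    rw [hμ.integral_sawtooth hδ0 hK, ← Finset.sum_sub_distrib]
    have hterm : ∀ k ∈ Finset.Icc 1 (2 * M),
        |1 / (Real.pi * k) * (charFun μ (2 * Real.pi * k * δ)).re *
            Real.sin (2 * Real.pi * k * ((w * √n - n) / 2)) -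
          1 / (Real.pi * k) * (charFun μ (Real.pi * k * √(2 / 3) / L)).re *
            Real.sin (Real.pi * k * (w * √n - n))| ≤
        m₁ / L * |√(n : ℝ) / √N - √(2 / 3)| := fun k hk => by
      have hk1 := hmod k hk
      have e2 : 2 * Real.pi * k * ((w * √n - n) / 2) = Real.pi * k * (w * √n - n) := by ring
      rw [e2, ← sub_mul, ← mul_sub, abs_mul, abs_mul]
      refine (mul_le_of_le_one_right (by positivity) (Real.abs_sin_le_one _)).trans ?_
      rw [abs_of_nonneg (by positivity : 0 ≤ 1 / (Real.pi * k))]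
      have h1 := hμ.abs_charFun_re_sub_le (2 * Real.pi * k * δ) (Real.pi * k * √(2 / 3) / L)
      have e3 : 2 * Real.pi * k * δ - Real.pi * k * √(2 / 3) / L =
          Real.pi * k / L * (√(n : ℝ) / √N - √(2 / 3)) := by
        rw [hδ]; field_simp
      rw [e3, abs_mul, abs_of_nonneg (by positivity : 0 ≤ Real.pi * k / L)] at h1
      -- The Fourier weight 1/(πk) cancels the factor k in the Lipschitz bound, so each mode
      -- contributes the same error.
      calc _ ≤ 1 / (Real.pi * k) * (Real.pi * k / L * |√(n : ℝ) / √N - √(2 / 3)| * m₁) := by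
            gcongr
        _ = _ := by field_simp
    refine (Finset.abs_sum_le_sum_abs _ _).trans ((Finset.sum_le_sum hterm).trans ?_)
    rw [Finset.sum_const, Nat.card_Icc, nsmul_eq_mul, Nat.add_sub_cancel]
    have h3 := abs_sqrt_div_sqrt_sub_le hN n
    calc ((2 * M : ℕ) : ℝ) * (m₁ / L * |√(n : ℝ) / √N - √(2 / 3)|) ≤
          (2 * L) * (m₁ / L * (1 / √N + 1 / (N * √N) * ((n : ℝ) - 2 * N / 3) ^ 2)) := by
          gcongr; push_cast; linarith
      _ = 2 * m₁ / √N + 2 * m₁ / (N * √N) * ((n : ℝ) - 2 * N / 3) ^ 2 := by field_simp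
      _ ≤ _ := by
          gcongr
          exact le_add_of_nonneg_right (by positivity)
  · have h1 : |∫ y, sawtooth (((w - 1 / (√N * L) * y) * √n - n) / 2) ∂μ| ≤ 1 / 2 := by
      have := norm_integral_le_of_norm_le (μ := μ)
        (f := fun y => sawtooth (((w - 1 / (√N * L) * y) * √n - n) / 2))
        (integrable_const (1 / 2 : ℝ)) (.of_forall fun y => abs_sawtooth_le _)
      simpa using this
    have h2 : |∑ k ∈ Finset.Icc 1 (2 * M), 1 / (Real.pi * k) *
        (charFun μ (Real.pi * k * √(2 / 3) / L)).re *
          Real.sin (Real.pi * k * (w * √n - n))| ≤ 2 * M := by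
      refine (Finset.abs_sum_le_sum_abs _ _).trans ((Finset.sum_le_sum fun k hk => ?_).trans
        hcard.le)
      have hk1 := hmod k hk
      rw [abs_mul, abs_mul]
      have h3 : |1 / (Real.pi * k)| ≤ 1 := by
        rw [abs_of_nonneg (by positivity), div_le_one (by positivity)]
        nlinarith [Real.pi_gt_three]
      exact mul_le_one₀ (mul_le_one₀ h3 (abs_nonneg _) (hμ.abs_charFun_re_le _)) (abs_nonneg _)
        (Real.abs_sin_le_one _)
    refine (abs_sub _ _).trans ?_
    have h3 : 1 / 2 + 2 * (M : ℝ) ≤ 3 * L := by linarith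
    have h4 : 3 * L * 1 ≤ 3 * L * (4 / (N : ℝ) ^ 2 * ((n : ℝ) - 2 * N / 3) ^ 2) := by gcongr
    have h5 : 0 ≤ 2 * m₁ / √N + 2 * m₁ / (N * √N) * ((n : ℝ) - 2 * N / 3) ^ 2 := by positivity
    calc _ ≤ 3 * L * (4 / (N : ℝ) ^ 2 * ((n : ℝ) - 2 * N / 3) ^ 2) := by linarith
      _ ≤ 3 * L * (4 / (N : ℝ) ^ 2 * ((n : ℝ) - 2 * N / 3) ^ 2) +
          (2 * m₁ / √N + 2 * m₁ / (N * √N) * ((n : ℝ) - 2 * N / 3) ^ 2) := by linarith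
      _ = _ := by ring

lemma abs_binMean_integral_sawtooth_sub_le (hμ : IsSmoothingLaw μ) {N : ℕ} (hN : 0 < N)
    (hL : 1 ≤ Real.log N) (w : ℝ) :
    |binMean N (fun n => ∫ y, sawtooth (((w - 1 / (√N * Real.log N) * y) * √n - n) / 2) ∂μ) -
      ∑ k ∈ Finset.Icc 1 (2 * ⌊Real.log N⌋₊), 1 / (Real.pi * k) *
        (charFun μ (Real.pi * k * √(2 / 3) / Real.log N)).re * limitMode N w k| ≤
      (3 * (∫ y, |y| ∂μ) + 99) * Real.log N ^ 3 / √N * (1 + |w|) ^ 3 := by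
  have := hμ.isProbabilityMeasure
  have h1 := abs_binMean_le_of_quadratic fun n (_ : n ≤ N) =>
    hμ.abs_integral_sawtooth_sub_le hN hL w n
  set L := Real.log N with hLdef
  set M := ⌊L⌋₊ with hM
  set m₁ := ∫ y, |y| ∂μ with hm₁
  have hm0 : 0 ≤ m₁ := integral_nonneg fun y => abs_nonneg y
  have hN1 : (1 : ℝ) ≤ N := by exact_mod_cast hN
  have hs0 : 0 < √(N : ℝ) := by positivity
  have hs1 : √(N : ℝ) ≤ N := by rw [Real.sqrt_le_left (by positivity)]; nlinarith
  have hML : (M : ℝ) ≤ L := Nat.floor_le (by linarith)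
  have hπ := Real.pi_pos
  rw [binMean_sub] at h1
  have e1 : binMean N (fun n => ∑ k ∈ Finset.Icc 1 (2 * M), 1 / (Real.pi * k) *
        (charFun μ (Real.pi * k * √(2 / 3) / L)).re * Real.sin (Real.pi * k * (w * √n - n))) =
      ∑ k ∈ Finset.Icc 1 (2 * M), 1 / (Real.pi * k) *
        (charFun μ (Real.pi * k * √(2 / 3) / L)).re *
          binMean N (fun n => Real.sin (Real.pi * k * (w * √n - n))) := by
    simp only [binMean, Finset.mul_sum]
    rw [Finset.sum_comm]
    exact Finset.sum_congr rfl fun k _ => Finset.sum_congr rfl fun n _ => by ring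
  rw [e1] at h1
  have h2 : |∑ k ∈ Finset.Icc 1 (2 * M), 1 / (Real.pi * k) *
        (charFun μ (Real.pi * k * √(2 / 3) / L)).re *
          binMean N (fun n => Real.sin (Real.pi * k * (w * √n - n))) -
      ∑ k ∈ Finset.Icc 1 (2 * M), 1 / (Real.pi * k) *
        (charFun μ (Real.pi * k * √(2 / 3) / L)).re * limitMode N w k| ≤
      96 * L ^ 3 * (1 + |w|) ^ 3 / √N := by
    rw [← Finset.sum_sub_distrib]
    have hterm : ∀ k ∈ Finset.Icc 1 (2 * M),
        |1 / (Real.pi * k) * (charFun μ (Real.pi * k * √(2 / 3) / L)).re *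
            binMean N (fun n => Real.sin (Real.pi * k * (w * √n - n))) -
          1 / (Real.pi * k) * (charFun μ (Real.pi * k * √(2 / 3) / L)).re * limitMode N w k| ≤
        12 * (2 * L) ^ 2 * (1 + |w|) ^ 3 / √N := fun k hk => by
      obtain ⟨hk1, hk2⟩ := Finset.mem_Icc.1 hk
      have hk1' : (1 : ℝ) ≤ k := by exact_mod_cast hk1
      have hk2' : (k : ℝ) ≤ 2 * L := by
        have : (k : ℝ) ≤ 2 * M := by exact_mod_cast hk2
        linarith
      rw [← mul_sub, abs_mul, abs_mul, abs_of_nonneg (by positivity : 0 ≤ 1 / (Real.pi * k))]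
      have h3 := abs_binMean_mode_sub_le hN w hk1
      have h4 : 1 / (Real.pi * k) ≤ 1 / (k : ℝ) := by
        gcongr
        nlinarith [Real.pi_gt_three]
      calc _ ≤ 1 / (k : ℝ) * 1 * (12 * (k : ℝ) ^ 3 * (1 + |w|) ^ 3 / √N) := by
            gcongr
            exact hμ.abs_charFun_re_le _
        _ = 12 * (k : ℝ) ^ 2 * (1 + |w|) ^ 3 / √N := by field_simp
        _ ≤ _ := by gcongr
    refine (Finset.abs_sum_le_sum_abs _ _).trans ((Finset.sum_le_sum hterm).trans ?_)
    rw [Finset.sum_const, Nat.card_Icc, nsmul_eq_mul, Nat.add_sub_cancel]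
    calc ((2 * M : ℕ) : ℝ) * (12 * (2 * L) ^ 2 * (1 + |w|) ^ 3 / √N) ≤
          (2 * L) * (12 * (2 * L) ^ 2 * (1 + |w|) ^ 3 / √N) := by
          gcongr; push_cast; linarith
      _ = _ := by ring
  refine (abs_sub_le _ _ _).trans ((add_le_add h1 h2).trans ?_)
  have h3 : 2 * m₁ / √N + (2 * m₁ / (N * √N) + 12 * L / (N : ℝ) ^ 2) * (2 * N / 9) ≤
      (3 * m₁ + 3) * (L / √N) := by
    have e : 2 * m₁ / √N + (2 * m₁ / (N * √N) + 12 * L / (N : ℝ) ^ 2) * (2 * N / 9) =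
        22 / 9 * m₁ * (1 / √N) + 8 / 3 * (L / N) := by field_simp; ring
    rw [e]
    have h4 : L / N ≤ L / √N := by gcongr
    have h5 : 1 / √(N : ℝ) ≤ L / √N := by gcongr
    have h6 : 0 ≤ L / √(N : ℝ) := by positivity
    nlinarith [mul_le_mul_of_nonneg_left h5 hm0, mul_nonneg hm0 h6]
  have h4 : L / √N ≤ L ^ 3 / √N * (1 + |w|) ^ 3 := by
    have h5 : L / √N ≤ L ^ 3 / √N := by gcongr; exact le_self_pow₀ hL (by norm_num)
    have h6 : 1 ≤ (1 + |w|) ^ 3 := one_le_pow₀ (by linarith [abs_nonneg w])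
    exact h5.trans (le_mul_of_one_le_right (by positivity) h6)
  have h5 := mul_le_mul_of_nonneg_left h4 (by positivity : 0 ≤ 3 * m₁ + 3)
  calc _ ≤ (3 * m₁ + 3) * (L ^ 3 / √N * (1 + |w|) ^ 3) + 96 * L ^ 3 * (1 + |w|) ^ 3 / √N := by
        linarith
    _ = _ := by ring

/-- Only k = 2j survives; the factor 2 in √6 = 2√(3/2) compensates 1/(π·2j). -/
lemma oscillatingSum_eq (N : ℕ) (w : ℝ) :
    oscillatingSum μ N w = √6 * φ w *
      ∑ k ∈ Finset.Icc 1 (2 * ⌊Real.log N⌋₊), 1 / (Real.pi * k) *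
        (charFun μ (Real.pi * k * √(2 / 3) / Real.log N)).re * limitMode N w k := by
  rw [sum_limitMode, oscillatingSum]
  have h6 : √(6 : ℝ) = 2 * √(3 / 2) := by
    rw [show (6 : ℝ) = 2 ^ 2 * (3 / 2) by norm_num, Real.sqrt_mul (by norm_num),
      Real.sqrt_sq (by norm_num)]
  rw [h6, Finset.mul_sum, Finset.mul_sum]
  refine Finset.sum_congr rfl fun j hj => ?_
  have hj1 : (j : ℝ) ≠ 0 := by
    have := (Finset.mem_Icc.1 hj).1
    positivity
  have hπ := Real.pi_ne_zero
  rw [limitMode, if_pos (even_two_mul j), dampingFactor]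
  push_cast
  have e1 : Real.pi * (2 * j) * √(2 / 3) / Real.log N = 2 * Real.pi * √(2 / 3) * j / Real.log N := by
    ring
  have e2 : Real.pi * (2 * (j : ℝ)) * w * √(2 * N / 3) = 2 * Real.pi * j * w * √(2 * N / 3) := by
    ring
  have e3 : -(Real.pi ^ 2 / 24) * (2 * (j : ℝ)) ^ 2 * w ^ 2 =
      -(Real.pi ^ 2 / 6) * (j : ℝ) ^ 2 * w ^ 2 := by ring
  rw [e1, e2, e3]
  field_simp

/-- The oscillating sum is, up to small errors, a lower bound for the approximation error. -/
lemma abs_oscillatingSum_le (hμ : IsSmoothingLaw μ) :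
    ∃ C : ℝ, 0 ≤ C ∧ ∀ N : ℕ, 3 ≤ N → ∀ w : ℝ, 1 ≤ w →
      |oscillatingSum μ N w| / √N ≤ normalApproxError N + C * (Real.log N ^ 5 / N) := by
  have := hμ.isProbabilityMeasure
  set m₁ := ∫ y, |y| ∂μ with hm₁
  set m₂ := ∫ y, y ^ 2 ∂μ with hm₂
  have hm0 : 0 ≤ m₁ := integral_nonneg fun y => abs_nonneg y
  have hm20 : 0 ≤ m₂ := integral_nonneg fun y => sq_nonneg y
  refine ⟨m₂ + (900 + 2 * m₁) + 2.5 * 64 * (3 * m₁ + 99), by positivity, fun N hN w hw => ?_⟩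
  have hN0 : 0 < N := by omega
  have hN1 : (1 : ℝ) ≤ N := by exact_mod_cast hN0
  have hL : 1 ≤ Real.log N := by
    rw [Real.le_log_iff_exp_le (by linarith)]
    have : (3 : ℝ) ≤ N := by exact_mod_cast hN
    linarith [Real.exp_one_lt_d9]
  have hkey := hμ.abs_binMean_integral_sawtooth_sub_le hN0 hL w
  rw [← hm₁] at hkey
  rw [oscillatingSum_eq]
  set L := Real.log N with hLdef
  set S := ∑ k ∈ Finset.Icc 1 (2 * ⌊L⌋₊), 1 / (Real.pi * k) *
        (charFun μ (Real.pi * k * √(2 / 3) / L)).re * limitMode N w k with hS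
  have hs0 : 0 < √(N : ℝ) := by positivity
  have hs2 : √(N : ℝ) * √N = N := Real.mul_self_sqrt (by positivity)
  have hs1 : 1 ≤ √(N : ℝ) := Real.one_le_sqrt.2 hN1
  set δ := 1 / (√(N : ℝ) * L) with hδ
  have hδ0 : 0 < δ := by positivity
  have hδ1 : δ ≤ 1 / √N := by
    rw [hδ]; gcongr; nlinarith
  have hδ2 : δ ^ 2 ≤ 1 / N := by
    calc δ ^ 2 ≤ (1 / √(N : ℝ)) ^ 2 := by gcongr
      _ = 1 / (N : ℝ) := by rw [div_pow, Real.sq_sqrt (by linarith), one_pow]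
  set f : ℝ → ℝ := fun y => mixCdf N (w - δ * y) - Φ (w - δ * y) with hf
  have hfm : Measurable f := (measurable_mixCdf_sub N).comp (by fun_prop)
  have hfi : Integrable f μ := hμ.integrable_of_bounded hfm 1 fun y => abs_mixCdf_sub_le_one N _
  set B : ℝ → ℝ := fun y => binMean N fun n => sawtooth (((w - δ * y) * √n - n) / 2) with hB
  have hBm : Measurable B := measurable_binMean N fun n => measurable_sawtooth.comp (by fun_prop)
  have hBi : Integrable B μ := hμ.integrable_of_bounded hBm (1 / 2) fun y =>
    abs_binMean_sawtooth_le N _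
  have hBint : ∫ y, B y ∂μ =
      binMean N (fun n => ∫ y, sawtooth (((w - δ * y) * √n - n) / 2) ∂μ) :=
    integral_binMean N fun n => hμ.integrable_of_bounded
      (measurable_sawtooth.comp (by fun_prop)) (1 / 2) fun y => abs_sawtooth_le _
  have h1 : |∫ y, f y ∂μ| ≤ normalApproxError N + m₂ / N := by
    have herr : 0 ≤ normalApproxError N :=
      (abs_nonneg _).trans (abs_mixCdf_sub_le_normalApproxError N one_pos)
    have hb : ∀ y, ‖f y‖ ≤ normalApproxError N + δ ^ 2 * y ^ 2 := fun y => by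
      rcases lt_or_ge 0 (w - δ * y) with h | h
      · have := abs_mixCdf_sub_le_normalApproxError N h
        have h2 : 0 ≤ δ ^ 2 * y ^ 2 := by positivity
        rw [Real.norm_eq_abs]
        linarith
      · have := abs_mixCdf_sub_le_one N (w - δ * y)
        rw [Real.norm_eq_abs]
        -- Where the shifted argument is not positive the sup error gives no control, but w ≥ 1 then
        -- forces δy ≥ 1, so the trivial bound 1 is paid for by the second moment.
        have h2 : 1 ≤ δ ^ 2 * y ^ 2 := by
          rw [← mul_pow]; exact one_le_pow₀ (by linarith)
        linarith
    have h2 := norm_integral_le_of_norm_le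
      ((integrable_const (normalApproxError N)).add (hμ.integrable_sq.const_mul (δ ^ 2)))
      (.of_forall hb)
    have h3 : ∫ y, (normalApproxError N + δ ^ 2 * y ^ 2) ∂μ =
        normalApproxError N + δ ^ 2 * m₂ := by
      rw [integral_add (integrable_const _) (hμ.integrable_sq.const_mul _), integral_const_mul]
      simp [hm₂]
    simp only [Pi.add_apply] at h2
    rw [h3] at h2
    refine h2.trans ?_
    have : δ ^ 2 * m₂ ≤ 1 / N * m₂ := by gcongr
    linarith [show 1 / (N : ℝ) * m₂ = m₂ / N by ring]
  have h2 : |∫ y, f y ∂μ - φ w * (√6 / √N) * ∫ y, B y ∂μ| ≤ (900 + 2 * m₁) / N := by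
    rw [← integral_const_mul, ← integral_sub hfi (hBi.const_mul _), ← Real.norm_eq_abs]
    have hb : ∀ y, ‖f y - φ w * (√6 / √N) * B y‖ ≤ 900 / N + 2 / N * |y| := fun y => by
      have h3 := abs_mixCdf_sub_sub_le hN0 (w - δ * y)
      have h4 := abs_stdPDF_sub_le (w - δ * y) w
      have h5 : |B y| ≤ 1 / 2 := abs_binMean_sawtooth_le N _
      have e : f y - φ w * (√6 / √N) * B y = (f y - φ (w - δ * y) * (√6 / √N) * B y) +
          (φ (w - δ * y) - φ w) * (√6 / √N) * B y := by ring
      have h6 : |(φ (w - δ * y) - φ w) * (√6 / √N) * B y| ≤ 2 / N * |y| := by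
        rw [sub_sub_cancel_left, abs_neg, abs_mul, abs_of_pos hδ0] at h4
        rw [abs_mul, abs_mul, abs_of_nonneg (by positivity : 0 ≤ √6 / √(N : ℝ))]
        calc _ ≤ 1 / √N * |y| * (2.5 / √N) * (1 / 2) := by
              gcongr
              · exact h4.trans (by gcongr)
              · exact sqrt_six_le
          _ = 1.25 / (√N * √N) * |y| := by ring
          _ ≤ _ := by rw [hs2]; gcongr; norm_num
      rw [e, Real.norm_eq_abs]
      exact (abs_add_le _ _).trans (add_le_add h3 h6)
    refine (norm_integral_le_of_norm_le
      ((integrable_const (900 / (N : ℝ))).add (hμ.integrable_abs.const_mul (2 / (N : ℝ))))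
      (.of_forall hb)).trans_eq ?_
    simp only [Pi.add_apply]
    rw [integral_add (integrable_const _) (hμ.integrable_abs.const_mul _), integral_const_mul]
    simp [← hm₁]
    ring
  rw [hBint] at h2
  set T := binMean N (fun n => ∫ y, sawtooth (((w - δ * y) * √n - n) / 2) ∂μ) with hT
  have hφ0 := stdPDF_nonneg w
  have h3 : |φ w * (√6 / √N) * (T - S)| ≤ 2.5 * 64 * (3 * m₁ + 99) * (L ^ 3 / N) := by
    rw [abs_mul, abs_of_nonneg (by positivity)]
    calc φ w * (√6 / √N) * |T - S| ≤
          φ w * (2.5 / √N) * ((3 * m₁ + 99) * L ^ 3 / √N * (1 + |w|) ^ 3) := by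
          gcongr; exact sqrt_six_le
      _ = (φ w * (1 + |w|) ^ 3) * (2.5 * (3 * m₁ + 99) * L ^ 3 / (√N * √N)) := by
          field_simp
      _ ≤ 64 * (2.5 * (3 * m₁ + 99) * L ^ 3 / (√N * √N)) := by
          gcongr; exact stdPDF_mul_le w
      _ = _ := by rw [hs2]; ring
  have e : √6 * φ w * S / √N = ∫ y, f y ∂μ -
      (∫ y, f y ∂μ - φ w * (√6 / √N) * T) - φ w * (√6 / √N) * (T - S) := by ring
  have h4 : |√6 * φ w * S| / √N ≤ normalApproxError N + m₂ / N + (900 + 2 * m₁) / N +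
      2.5 * 64 * (3 * m₁ + 99) * (L ^ 3 / N) := by
    rw [show |√6 * φ w * S| / √N = |√6 * φ w * S / √N| by rw [abs_div, abs_of_pos hs0], e]
    exact (abs_sub _ _).trans (add_le_add ((abs_sub _ _).trans (add_le_add h1 h2)) h3)
  have h5 : 1 / (N : ℝ) ≤ L ^ 5 / N := by gcongr; exact one_le_pow₀ hL
  have h6 : L ^ 3 / N ≤ L ^ 5 / N :=
    div_le_div_of_nonneg_right (pow_le_pow_right₀ hL (by norm_num)) (by positivity)
  have h7 := mul_le_mul_of_nonneg_left h5 hm20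
  have h8 := mul_le_mul_of_nonneg_left h5 (by positivity : 0 ≤ 900 + 2 * m₁)
  have h9 := mul_le_mul_of_nonneg_left h6 (by positivity : 0 ≤ 2.5 * 64 * (3 * m₁ + 99))
  rw [mul_one_div] at h7 h8
  linarith

end IsSmoothingLaw

/-! ### Size of the oscillating sum -/

/-- The bracket is the exact sum of 4^(-k) over 2 ≤ k ≤ M, which lets the induction close. -/
lemma sub_le_sum_Icc_of_geometric {a : ℕ → ℝ} {b : ℝ}
    (ha : ∀ k, 2 ≤ k → |a k| ≤ b * (1 / 4) ^ k) {M : ℕ} (hM : 1 ≤ M) :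
    a 1 - b * (1 / 12 - 1 / 3 * (1 / 4) ^ M) ≤ ∑ k ∈ Finset.Icc 1 M, a k := by
  induction M, hM using Nat.le_induction with
  | base => norm_num
  | succ M hM ih =>
    rw [Finset.sum_Icc_succ_top (by omega)]
    have h1 := (abs_le.1 (ha (M + 1) (by omega))).1
    rw [pow_succ] at h1 ⊢
    linarith

namespace IsSmoothingLaw

variable {μ : Measure ℝ}

lemma abs_dampingFactor_le (hμ : IsSmoothingLaw μ) (N k : ℕ) : |dampingFactor μ N k| ≤ 1 :=
  hμ.abs_charFun_re_le _

lemma bddAbove_abs_oscillatingSum (hμ : IsSmoothingLaw μ) (N : ℕ) :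
    BddAbove (Set.range fun w : Set.Ici (1 : ℝ) => |oscillatingSum μ N w|) := by
  refine ⟨√(3 / 2) * 1 * ∑ k ∈ Finset.Icc 1 ⌊Real.log N⌋₊, 1 / (Real.pi * k), ?_⟩
  rintro _ ⟨⟨w, hw⟩, rfl⟩
  simp only [oscillatingSum]
  have hφ := stdPDF_nonneg w
  rw [abs_mul, abs_mul, abs_of_nonneg (Real.sqrt_nonneg _), abs_of_nonneg hφ]
  gcongr
  · exact stdPDF_le_one w
  · refine (Finset.abs_sum_le_sum_abs _ _).trans (Finset.sum_le_sum fun k _ => ?_)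
    rw [abs_mul, abs_mul, abs_mul, abs_of_nonneg (by positivity : 0 ≤ 1 / (Real.pi * (k : ℝ))),
      Real.abs_exp]
    have h1 : Real.exp (-(Real.pi ^ 2 / 6) * (k : ℝ) ^ 2 * w ^ 2) ≤ 1 := by
      rw [Real.exp_le_one_iff, neg_mul, neg_mul]
      exact neg_nonpos.2 (by positivity)
    calc _ ≤ 1 / (Real.pi * (k : ℝ)) * 1 * 1 * 1 := by
          gcongr
          · exact hμ.abs_dampingFactor_le N k
          · exact Real.abs_sin_le_one _
      _ = _ := by ring

lemma abs_oscillatingSum_le_sup (hμ : IsSmoothingLaw μ) (N : ℕ) {w : ℝ} (hw : 1 ≤ w) :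
    |oscillatingSum μ N w| ≤ oscillatingSumSup μ N :=
  le_ciSup (hμ.bddAbove_abs_oscillatingSum N) ⟨w, hw⟩

lemma exists_le_oscillatingSumSup (hμ : IsSmoothingLaw μ) :
    ∃ N₀ : ℕ, ∀ N : ℕ, N₀ ≤ N →
      φ 2 * (Real.exp (-7) / (4 * Real.pi)) ≤ oscillatingSumSup μ N := by
  have := hμ.isProbabilityMeasure
  set m₁ := ∫ y, |y| ∂μ with hm₁
  have hm0 : 0 ≤ m₁ := integral_nonneg fun y => abs_nonneg y
  -- N ≥ 6 gives r ≥ 2, hence w ≤ 2 below; log N ≥ 14m₁ + 1 keeps the first damping factor at least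
  -- 1/2.
  refine ⟨max 6 ⌈Real.exp (14 * m₁ + 1)⌉₊, fun N hN => ?_⟩
  have hN6 : (6 : ℝ) ≤ N := by exact_mod_cast (le_max_left _ _).trans hN
  have hL : 14 * m₁ + 1 ≤ Real.log N := by
    rw [Real.le_log_iff_exp_le (by linarith)]
    exact (Nat.le_ceil _).trans (by exact_mod_cast (le_max_right _ _).trans hN)
  have hL1 : 1 ≤ Real.log N := by linarith
  have hπ := Real.pi_pos
  have hπ3 := Real.pi_gt_three
  have hπ4 := Real.pi_lt_d2
  set r := √(2 * (N : ℝ) / 3) with hr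
  have hr2 : 2 ≤ r := by rw [hr, Real.le_sqrt (by norm_num) (by positivity)]; linarith
  -- With wr = ⌈r⌉ + 1/4 the sine in the first mode equals 1, while w stays in [1, 2].
  set w := ((⌈r⌉₊ : ℝ) + 1 / 4) / r with hw
  have hr0 : 0 < r := by linarith
  have hw1 : 1 ≤ w := by
    rw [hw, one_le_div hr0]; linarith [Nat.le_ceil r]
  have hw2 : w ≤ 2 := by
    rw [hw, div_le_iff₀ hr0]; linarith [Nat.ceil_lt_add_one hr0.le]
  refine le_trans ?_ (hμ.abs_oscillatingSum_le_sup N hw1)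
  refine le_trans ?_ (le_abs_self _)
  set q := Real.exp (-(Real.pi ^ 2 / 6) * w ^ 2) with hq
  have hq0 : 0 < q := Real.exp_pos _
  have hq1 : Real.exp (-7) ≤ q := by
    rw [hq]
    apply Real.exp_le_exp.2
    have h1 : w ^ 2 ≤ 4 := by nlinarith
    have h2 : Real.pi ^ 2 ≤ 10 := by nlinarith
    nlinarith
  have hq2 : q ≤ 1 / 2 := by
    have h1 : 1 ≤ w ^ 2 := one_le_pow₀ hw1
    have h2 : 9 ≤ Real.pi ^ 2 := by nlinarith
    have h3 : q ≤ Real.exp (-1) := Real.exp_le_exp.2 (by nlinarith)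
    have h4 : Real.exp (-1) ≤ 1 / 2 := by
      rw [Real.exp_neg, one_div]
      exact inv_anti₀ (by norm_num) (by linarith [Real.exp_one_gt_d9])
    linarith
  have hexp : ∀ k : ℕ, Real.exp (-(Real.pi ^ 2 / 6) * (k : ℝ) ^ 2 * w ^ 2) = q ^ (k ^ 2) :=
    fun k => by
      rw [hq, ← Real.exp_nat_mul]; congr 1; push_cast; ring
  have hdamp : 1 / 2 ≤ dampingFactor μ N 1 := by
    have h1 := hμ.abs_charFun_re_sub_le (2 * Real.pi * √(2 / 3) * (1 : ℕ) / Real.log N) 0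
    rw [charFun_zero, probReal_univ, Complex.ofReal_one, Complex.one_re, sub_zero,
      abs_of_nonneg (by positivity : 0 ≤ 2 * Real.pi * √(2 / 3) * (1 : ℕ) / Real.log N)] at h1
    have h2 : √(2 / 3 : ℝ) ≤ 1 := by rw [Real.sqrt_le_left (by norm_num)]; norm_num
    have h3 : 2 * Real.pi * √(2 / 3) * (1 : ℕ) / Real.log N * m₁ ≤ 1 / 2 := by
      rw [div_mul_eq_mul_div, div_le_iff₀ (by linarith)]
      calc 2 * Real.pi * √(2 / 3) * (1 : ℕ) * m₁ ≤ 2 * 3.15 * 1 * (1 : ℕ) * m₁ := by gcongr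
        _ ≤ _ := by push_cast; linarith
    have h4 := (abs_le.1 (h1.trans h3)).1
    rw [dampingFactor]
    linarith
  set a : ℕ → ℝ := fun k => 1 / (Real.pi * k) * dampingFactor μ N k *
        Real.exp (-(Real.pi ^ 2 / 6) * (k : ℝ) ^ 2 * w ^ 2) *
        Real.sin (2 * Real.pi * k * w * r) with ha
  have ha1 : q / (2 * Real.pi) ≤ a 1 := by
    have h1 : Real.sin (2 * Real.pi * ((1 : ℕ) : ℝ) * w * r) = 1 := by
      have : 2 * Real.pi * ((1 : ℕ) : ℝ) * w * r = Real.pi / 2 + (⌈r⌉₊ : ℝ) * (2 * Real.pi) := by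
        rw [hw]; field_simp; push_cast; ring
      rw [this, Real.sin_add_nat_mul_two_pi, Real.sin_pi_div_two]
    simp only [ha]
    rw [h1, hexp]
    calc q / (2 * Real.pi) = 1 / (Real.pi * (1 : ℕ)) * (1 / 2) * q ^ (1 ^ 2) * 1 := by
          field_simp; simp
      _ ≤ _ := by gcongr
  have hak : ∀ k, 2 ≤ k → |a k| ≤ q / Real.pi * (1 / 4) ^ k := fun k hk => by
    have hk2 : (2 : ℝ) ≤ k := by exact_mod_cast hk
    simp only [ha]
    rw [hexp, abs_mul, abs_mul, abs_mul,
      abs_of_nonneg (by positivity : 0 ≤ 1 / (Real.pi * (k : ℝ))), abs_of_pos (pow_pos hq0 _)]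
    -- Since q ≤ 1/2 and k² ≥ 2k, the higher modes total at most q/(12π), against q/(2π) for the
    -- first.
    have h1 : q ^ (k ^ 2) ≤ 2 * q * (1 / 4) ^ k := by
      calc q ^ (k ^ 2) ≤ q ^ (2 * k) :=
            pow_le_pow_of_le_one hq0.le (by linarith) (by nlinarith)
        _ = q * q ^ (2 * k - 1) := by rw [← pow_succ']; congr 1; omega
        _ ≤ q * (1 / 2) ^ (2 * k - 1) := by gcongr
        _ = 2 * q * ((1 / 2) * (1 / 2) ^ (2 * k - 1)) := by ring
        _ = 2 * q * (1 / 4) ^ k := by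
            rw [← pow_succ', show 2 * k - 1 + 1 = 2 * k by omega, pow_mul]; norm_num
    calc _ ≤ 1 / (Real.pi * 2) * 1 * (2 * q * (1 / 4) ^ k) * 1 := by
          gcongr
          · exact hμ.abs_dampingFactor_le N k
          · exact Real.abs_sin_le_one _
      _ = _ := by field_simp
  have hsum := sub_le_sum_Icc_of_geometric hak (Nat.le_floor (by simpa using hL1) :
    1 ≤ ⌊Real.log N⌋₊)
  have hsum2 : Real.exp (-7) / (4 * Real.pi) ≤ ∑ k ∈ Finset.Icc 1 ⌊Real.log N⌋₊, a k := by
    have h1 : Real.exp (-7) / (4 * Real.pi) ≤ q / (4 * Real.pi) := by gcongr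
    have h2 : 0 ≤ q / Real.pi * (1 / 3 * (1 / 4) ^ ⌊Real.log N⌋₊) := by positivity
    have h3 : q / (4 * Real.pi) = q / Real.pi / 4 := by ring
    have h4 : q / (2 * Real.pi) = q / Real.pi / 2 := by ring
    have h5 : 0 < q / Real.pi := by positivity
    linarith
  have hφ2 : φ 2 ≤ √(3 / 2) * φ w := by
    have h1 : φ 2 ≤ φ w := by
      rw [stdPDF_eq, stdPDF_eq]
      have : -(2 : ℝ) ^ 2 / 2 ≤ -w ^ 2 / 2 := by nlinarith
      gcongr
    have h2 : 1 ≤ √(3 / 2 : ℝ) := Real.one_le_sqrt.2 (by norm_num)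
    nlinarith [stdPDF_nonneg w]
  rw [oscillatingSum]
  exact mul_le_mul hφ2 hsum2 (by positivity) (mul_nonneg (by positivity) (stdPDF_nonneg w))

end IsSmoothingLaw

/-- If `s - C ρ ≤ e`, `c < s` eventually, and `c < e`, then `e` exceeds `s + R > c` for some
remainder `R = O(ρ)`. -/
lemma exists_remainder {s e c ρ : ℕ → ℝ} {P : ℕ → Prop} {C : ℝ} {N₀ : ℕ} (hC : 0 ≤ C)
    (hρ : ∀ N, P N → 1 / (N : ℝ) ≤ ρ N) (hP : ∀ N, P N → 0 < N)
    (hse : ∀ N, P N → s N ≤ e N + C * ρ N) (hce : ∀ N, P N → c N < e N)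
    (hcs : ∀ N, P N → N₀ ≤ N → c N < s N) :
    ∃ (C : ℝ) (R : ℕ → ℝ), ∀ N, P N →
      |R N| ≤ C * ρ N ∧ s N + R N ≤ e N ∧ c N < s N + R N := by
  -- The finitely many N < N₀ are absorbed into the constant; the weight N matches the lower bound
  -- 1/N ≤ ρ(N).
  set K := ∑ N ∈ Finset.range N₀, |e N - s N| * N with hK
  have hK0 : 0 ≤ K := Finset.sum_nonneg fun N _ => by positivity
  refine ⟨C + K, fun N => if N₀ ≤ N then min 0 (e N - s N) else e N - s N, fun N hN => ?_⟩
  have hN1 : (0 : ℝ) < N := by exact_mod_cast hP N hN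
  have hρ0 : 0 ≤ ρ N := le_trans (by positivity) (hρ N hN)
  have hs := hse N hN
  have he := hce N hN
  by_cases h : N₀ ≤ N
  · simp only [if_pos h]
    have hc := hcs N hN h
    have h2 : 0 ≤ K * ρ N := by positivity
    have h3 : 0 ≤ C * ρ N := by positivity
    rcases le_total 0 (e N - s N) with h1 | h1
    · rw [min_eq_left h1, abs_zero]
      exact ⟨by linarith, by linarith, by linarith⟩
    · rw [min_eq_right h1, abs_of_nonpos h1]
      exact ⟨by linarith, by linarith, by linarith⟩
  · simp only [if_neg h]
    refine ⟨?_, by linarith, by linarith⟩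
    have h1 : |e N - s N| * N ≤ K :=
      Finset.single_le_sum (f := fun N : ℕ => |e N - s N| * N) (fun N _ => by positivity)
        (Finset.mem_range.2 (not_le.1 h))
    calc |e N - s N| = |e N - s N| * N * (1 / N) := by field_simp
      _ ≤ K * ρ N := mul_le_mul h1 (hρ N hN) (by positivity) hK0
      _ ≤ _ := mul_le_mul_of_nonneg_right (by linarith) hρ0

theorem theorem1p2 :
    ∃ c : ℝ, 0 < c ∧
      (∃ C₀ : ℝ, ∀ N : ℕ, 0 < N → 3 ∣ N →
        c / √(N : ℝ) < normalApproxError N ∧ normalApproxError N ≤ C₀ / √(N : ℝ)) ∧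
      ∀ μ : MeasureTheory.Measure ℝ, IsSmoothingLaw μ →
        (∃ (C : ℝ) (R : ℕ → ℝ), ∀ N : ℕ, 0 < N → 3 ∣ N →
          |R N| ≤ C * (Real.log N ^ 5 / N) ∧
          oscillatingSumSup μ N / √(N : ℝ) + R N ≤ normalApproxError N ∧
          c / √(N : ℝ) < oscillatingSumSup μ N / √(N : ℝ) + R N) ∧
        ∃ N₀ : ℕ, ∀ N : ℕ, N₀ ≤ N → 3 ∣ N → c < oscillatingSumSup μ N := by
  set κ := φ 2 * (Real.exp (-7) / (4 * Real.pi)) with hκ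
  have hκ0 : 0 < κ := mul_pos (gaussianPDFReal_pos 0 1 2 one_ne_zero) (by positivity)
  -- Any value strictly below both 1/30 (atom at the origin) and κ (first mode) would do.
  set c := min (1 / 31) (κ / 2) with hc
  have hc0 : 0 < c := by positivity
  have hc1 : c < 1 / 30 := (min_le_left _ _).trans_lt (by norm_num)
  have hc2 : c < κ := (min_le_right _ _).trans_lt (by linarith)
  have hlow : ∀ N : ℕ, 0 < N → c / √(N : ℝ) < normalApproxError N := fun N hN => by
    have : 0 < √(N : ℝ) := Real.sqrt_pos.2 (by exact_mod_cast hN)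
    exact lt_of_lt_of_le (by gcongr) (inv_sqrt_le_normalApproxError hN)
  refine ⟨c, hc0, ⟨902, fun N hN _ => ⟨hlow N hN, normalApproxError_le hN⟩⟩, fun μ hμ => ?_⟩
  obtain ⟨N₀, hN₀⟩ := hμ.exists_le_oscillatingSumSup
  refine ⟨?_, N₀, fun N hN _ => hc2.trans_le (hN₀ N hN)⟩
  obtain ⟨C, hC0, hC⟩ := hμ.abs_oscillatingSum_le
  -- Divisibility by 3 gives N ≥ 3 > e.
  have hlog : ∀ N : ℕ, 0 < N ∧ 3 ∣ N → 1 ≤ Real.log N := fun N hN => by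
    have : (3 : ℝ) ≤ N := by exact_mod_cast Nat.le_of_dvd hN.1 hN.2
    rw [Real.le_log_iff_exp_le (by linarith)]
    linarith [Real.exp_one_lt_d9]
  have hs0 : ∀ N : ℕ, 0 < N → 0 < √(N : ℝ) := fun N hN => Real.sqrt_pos.2 (by exact_mod_cast hN)
  obtain ⟨C', R, hR⟩ := exists_remainder (s := fun N => oscillatingSumSup μ N / √(N : ℝ))
    (e := normalApproxError) (c := fun N => c / √(N : ℝ)) (ρ := fun N => Real.log N ^ 5 / N)
    (P := fun N => 0 < N ∧ 3 ∣ N) (N₀ := N₀) hC0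
    (fun N hN => div_le_div_of_nonneg_right (one_le_pow₀ (hlog N hN)) N.cast_nonneg)
    (fun N hN => hN.1)
    (fun N hN => by
      rw [div_le_iff₀ (hs0 N hN.1)]
      refine ciSup_le fun ⟨w, hw⟩ => ?_
      rw [← div_le_iff₀ (hs0 N hN.1)]
      exact hC N (Nat.le_of_dvd hN.1 hN.2) w hw)
    (fun N hN => hlow N hN.1)
    (fun N hN h => div_lt_div_of_pos_right (hc2.trans_le (hN₀ N h)) (hs0 N hN.1))
  exact ⟨C', R, fun N hN h3 => hR N ⟨hN, h3⟩⟩
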